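/- **Setting.** Let $n,K\ge 2$ be integers and $\beta\ge 1$, with $\beta<\sqrt{5/3}$ if $K\ge 3$. Let $\Sigma_\beta$ be the set of labelings $\sigma:[n]\to[K]$ all of whose classes have size in $[\frac{n}{\beta K},\frac{\beta n}{K}]$. For $0\le b<a<n$ and $\sigma_0\in\Sigma_\beta$, $A\sim\mathrm{SBM}(\sigma_0)$ is the random simple graph on $[n]$ with independent edges, $\{i,j\}$ being present with probability $a/n$ if $\sigma_0(i)=\sigma_0(j)$ and $b/n$ otherwise. We write $r(\sigma,\tau)=\min_{\pi\in S_K}\frac1n\#\{i:\sigma(i)\ne\pi(\tau(i))\}$, $$I=-2\log\Big(\sqrt{\tfrac an\tfrac bn}+\sqrt{(1-\tfrac an)(1-\tfrac bn)}\Big),\qquad \mathrm{Signal}=\begin{cases} nI/2,&K=2,\\ nI/(\beta K),&K\ge3,\end{cases}\qquad t^\star=\tfrac12\log\frac{a(1-b/n)}{b(1-a/n)},$$ $$T_A(\sigma)=\sum_{i<j}(A_{ij}-\lambda)\mathbf 1\{\sigma(i)=\sigma(j)\},\qquad \lambda=-\tfrac{w}{t^\star}\log\!\big(\tfrac an e^{-t^\star}+1-\tfrac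 an\big)+\tfrac{1-w}{t^\star}\log\!\big(\tfrac bn e^{t^\star}+1-\tfrac bn\big),$$ where $w=\frac12$ if $K=2$ and $w\in[0,1]$ is arbitrary if $K\ge3$. For $C>0$ let $\mathcal G_C$ be the set of graphs on $[n]$ of maximal degree at most $C\max\{a,\log n\}$, and $\Delta_a=2C\max\{a,\log n\}$. **Estimator.** For $\varepsilon>0$, $\hat\sigma_f$ denotes any $\varepsilon$-node-DP mechanism from all graphs on $[n]$ to $\Sigma_\beta$ (that is, $\mathbb P(\hat\sigma_f(A)\in S)\le e^{\varepsilon}\,\mathbb P(\hat\sigma_f(A')\in S)$ for all $S$ whenever $A\neq A'$ differ only in edges incident to one vertex) such that for $A\in\mathcal G_C$ the law of $\hat\sigma_f(A)$ is that of the exponential mechanism, $\mathbb P(\hat\sigma_f(A)=\sigma)\propto \exp\{\frac{\varepsilon}{4\Delta_a}T_A(\sigma)\}\mathbf 1\{\sigma\in\Sigma_\beta\}$. **Theorem.** There is an absolute constant $C_{\rm env}>0$ such that the following holds. (0) For all $C\ge C_{\rm env}$, $n\ge 2$, $0\le b\le a\le n$ and every $\sigma_0$, $\mathbb P(A\in\mathcal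 G_C)\ge 1-e^{-10(a+\log n)}$. Moreover, for all $C>0$ and $\varepsilon>0$, an estimator $\hat\sigma_f$ as above exists as soon as $\Sigma_\beta\neq\emptyset$. Let $C_{\rm mg}>0$ and $0<\rho_-\le\rho_+<1$. There are constants $C_s,c_0,c_1,C_0,C_1>0$ and a sequence $\delta_n\to0$, depending only on $C_{\rm mg},\rho_-,\rho_+$, such that the following holds for all $n,K,\beta,a,b,w$ as above with $$\rho_-\le \tfrac ba\le\rho_+,\qquad \mathrm{Signal}\ge C_s\log(nK),\qquad \log(nK)\ge C_{\rm mg}K\log K,$$ all $C\ge C_{\rm env}$, $\varepsilon>0$, $\sigma_0\in\Sigma_\beta$ and all estimators $\hat\sigma_f$. Put $B=C_0\frac{K\log(nK)}{nI}$, $\eta=\frac{\varepsilon}{4\Delta_a}$, $\gamma_0=\eta-B$ and $s^\star(\alpha)=\frac{C_1\log(nK)+\log(4/\alpha)}{\gamma_0}$. (1) If $\gamma_0>0$, then for every $0<\alpha<\frac12$ $$\mathbb E\,r(\sigma_0,\hat\sigma_f)\le \exp\{-(1+\delta_n)\,\mathrm{Signal}+t^\star s^\star(\alpha)\}+\alpha+e^{-c_0\mathrm{Signal}}+e^{-c_1(a+\log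 n)}.$$ (2) There is $L>0$, depending only on $C_{\rm mg},\rho_-,\rho_+$, such that if $\eta\ge 2B$, $c_3>0$ and $\alpha=\frac1{nK}e^{-c_3\varepsilon/2}$, then $$s^\star(\alpha)\le L\,\frac{\Delta_a\log(nK)}{\varepsilon}+L\,c_3\,\Delta_a .$$ (3) For every $\kappa\in(0,1)$ there is $L>0$, depending only on $C_{\rm mg},\rho_-,\rho_+,\kappa$, such that if $\eta\ge2B$, $c_3>0$ and $a\le(1-\kappa)n$, then $$\mathbb E\,r(\sigma_0,\hat\sigma_f)\le \exp\Big\{-(1+\delta_n)\,\mathrm{Signal}+L\,\frac{\Delta_a\log(nK)}{\varepsilon}+L\,c_3\,\Delta_a\Big\}+\frac1{nK}e^{-c_3\varepsilon/2}+e^{-c_0\mathrm{Signal}}+e^{-c_1(a+\log n)}.$$ -/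

import Mathlib

open Filter Topology

noncomputable section

namespace NodeDPSBM

/-! ### Labelings, balance, mismatch ratio -/

/-- The set of `β`-balanced labelings `σ : [n] → [K]`: every class has between `n / (β K)` and
`β n / K` elements. -/
def balanced (n K : ℕ) (β : ℝ) : Set (Fin n → Fin K) :=
  {σ | ∀ k : Fin K,
    (n : ℝ) / (β * K) ≤ ((Finset.univ.filter (fun i => σ i = k)).card : ℝ) ∧
    ((Finset.univ.filter (fun i => σ i = k)).card : ℝ) ≤ β * n / K}

/-- The permutation-invariant mismatch ratio
`min_{π ∈ S_K} (1/n) #{i : σ i ≠ π (τ i)}`. -/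
def mismatch {n K : ℕ} (σ τ : Fin n → Fin K) : ℝ :=
  Finset.univ.inf' Finset.univ_nonempty
    (fun π : Equiv.Perm (Fin K) =>
      ((Finset.univ.filter (fun i => σ i ≠ π (τ i))).card : ℝ) / n)

/-! ### The stochastic block model -/

/-- The index pairs `i < j`. -/
def pairs (n : ℕ) : Finset (Fin n × Fin n) :=
  Finset.univ.filter (fun e => e.1 < e.2)

/-- Connection probability of `i` and `j`: `a / n` within a class, `b / n` across classes. -/
def edgeProb {n K : ℕ} (a b : ℝ) (σ₀ : Fin n → Fin K) (i j : Fin n) : ℝ :=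
  if σ₀ i = σ₀ j then a / n else b / n

open Classical in
/-- The probability of the graph `A` under the stochastic block model with truth `σ₀`: the edges
`{i, j}`, `i < j`, are independent Bernoulli variables with parameters `edgeProb a b σ₀ i j`. -/
def sbmProb {n K : ℕ} (a b : ℝ) (σ₀ : Fin n → Fin K) (A : SimpleGraph (Fin n)) : ℝ :=
  ∏ e ∈ pairs n,
    if A.Adj e.1 e.2 then edgeProb a b σ₀ e.1 e.2 else 1 - edgeProb a b σ₀ e.1 e.2

/-- Rényi divergence of order `1/2` between `Ber(a/n)` and `Ber(b/n)`. -/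
def renyiI (n : ℕ) (a b : ℝ) : ℝ :=
  -2 * Real.log (√(a / n * (b / n)) + √((1 - a / n) * (1 - b / n)))

/-- The signal: `n I / 2` for `K = 2` and `n I / (β K)` for `K ≥ 3`. -/
def signal (n K : ℕ) (β a b : ℝ) : ℝ :=
  if K = 2 then n * renyiI n a b / 2 else n * renyiI n a b / (β * K)

/-! ### The penalized likelihood score -/

/-- The Chernoff tilt `t⋆`. -/
def tStar (n : ℕ) (a b : ℝ) : ℝ :=
  1 / 2 * Real.log (a * (1 - b / n) / (b * (1 - a / n)))

/-- The penalty level `λ`; the weight `w ∈ [0, 1]` is only used for `K ≥ 3`. -/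
def penalty (n K : ℕ) (a b w : ℝ) : ℝ :=
  let t := tStar n a b
  if K = 2 then
    -(1 / (2 * t)) * Real.log (a / n * Real.exp (-t) + 1 - a / n)
      + 1 / (2 * t) * Real.log (b / n * Real.exp t + 1 - b / n)
  else
    -(w / t) * Real.log (a / n * Real.exp (-t) + 1 - a / n)
      + (1 - w) / t * Real.log (b / n * Real.exp t + 1 - b / n)

open Classical in
/-- The score `T_A(σ) = ∑_{i<j} (A_ij - λ) 1{σ i = σ j}`. -/
def score {n K : ℕ} (lam : ℝ) (A : SimpleGraph (Fin n)) (σ : Fin n → Fin K) : ℝ :=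
  ∑ e ∈ pairs n,
    ((if A.Adj e.1 e.2 then 1 else 0) - lam) * (if σ e.1 = σ e.2 then 1 else 0)

/-! ### The degree envelope and the restricted exponential mechanism -/

open Classical in
/-- The degree envelope: graphs with maximal degree at most `C max{a, log n}`. -/
def envelope (n : ℕ) (C a : ℝ) : Set (SimpleGraph (Fin n)) :=
  {A | (A.maxDegree : ℝ) ≤ C * max a (Real.log n)}

/-- The sensitivity level `Δ_a = 2 C max{a, log n}`. -/
def sens (n : ℕ) (C a : ℝ) : ℝ := 2 * C * max a (Real.log n)

open Classical in
/-- The probability that the exponential mechanism with score `T_A`, sensitivity `Δ_a`, privacy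
budget `ε₀ = ε / 2` and candidate set `balanced n K β` outputs `σ` on input `A`. -/
def emProb {n K : ℕ} (β a b w C ε : ℝ) (A : SimpleGraph (Fin n)) (σ : Fin n → Fin K) : ℝ :=
  (if σ ∈ balanced n K β then
      Real.exp (ε / 2 / (2 * sens n C a) * score (penalty n K a b w) A σ) else 0) /
    ∑ τ ∈ Finset.univ.filter (fun τ : Fin n → Fin K => τ ∈ balanced n K β),
      Real.exp (ε / 2 / (2 * sens n C a) * score (penalty n K a b w) A τ)

/-! ### Node-level differential privacy and the estimator -/

/-- Two distinct graphs are node-adjacent if they differ only in edges incident to one vertex. -/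
def NodeAdjacent {n : ℕ} (A A' : SimpleGraph (Fin n)) : Prop :=
  A ≠ A' ∧ ∃ v : Fin n, ∀ i j : Fin n, i ≠ v → j ≠ v → (A.Adj i j ↔ A'.Adj i j)

/-- Pure `ε`-node differential privacy of a randomized map from graphs to a discrete space. -/
def IsNodeDP {n : ℕ} {Y : Type*} (ε : ℝ) (M : SimpleGraph (Fin n) → PMF Y) : Prop :=
  ∀ A A' : SimpleGraph (Fin n), NodeAdjacent A A' → ∀ S : Set Y,
    (M A).toOuterMeasure S ≤ ENNReal.ofReal (Real.exp ε) * (M A').toOuterMeasure S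

/-- `M` is a version of the node-private estimator: an `ε`-node-DP mechanism on all graphs with
values in the balanced labelings, which on the degree envelope has the law of the exponential
mechanism. -/
structure IsPrivateEstimator {n K : ℕ} (β a b w C ε : ℝ)
    (M : SimpleGraph (Fin n) → PMF (Fin n → Fin K)) : Prop where
  nodeDP : IsNodeDP ε M
  mem_balanced : ∀ A, (M A).support ⊆ balanced n K β
  eq_em : ∀ A ∈ envelope n C a, ∀ σ, M A σ = ENNReal.ofReal (emProb β a b w C ε A σ)

open Classical in
/-- The expected mismatch ratio `E r(σ₀, σ̂)`, where `A ∼ SBM(σ₀)` and `σ̂ ∼ M A`. -/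
def expectedMismatch {n K : ℕ} (a b : ℝ) (σ₀ : Fin n → Fin K)
    (M : SimpleGraph (Fin n) → PMF (Fin n → Fin K)) : ℝ :=
  ∑ A : SimpleGraph (Fin n), sbmProb a b σ₀ A * ∑ σ, (M A σ).toReal * mismatch σ₀ σ

open Classical in
/-- The probability that the block model with truth `σ₀` produces a graph in `H`. -/
def sbmMeasure {n K : ℕ} (a b : ℝ) (σ₀ : Fin n → Fin K) (H : Set (SimpleGraph (Fin n))) : ℝ :=
  ∑ A ∈ Finset.univ.filter (fun A : SimpleGraph (Fin n) => A ∈ H), sbmProb a b σ₀ A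

/-! ### Parameters of the risk bound -/

/-- `η = ε / (4 Δ_a)`. -/
def eta (n : ℕ) (C a ε : ℝ) : ℝ := ε / (4 * sens n C a)

/-- `B = C₀ K log(nK) / (n I)`. -/
def bias (n K : ℕ) (C₀ a b : ℝ) : ℝ := C₀ * (K * Real.log (n * K) / (n * renyiI n a b))

/-- `s⋆(α) = (C₁ log(nK) + log(4/α)) / (η - B)`. -/
def sStar (n K : ℕ) (C C₀ C₁ a b ε α : ℝ) : ℝ :=
  (C₁ * Real.log (n * K) + Real.log (4 / α)) / (eta n C a ε - bias n K C₀ a b)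

/-- The standing assumptions on the block model (with constant SNR: `rlo ≤ b/a ≤ rhi`), together with
signal-entropy separation and mild growth of `K`. -/
structure Regime (rlo rhi Cs Cmg : ℝ) (n K : ℕ) (β a b : ℝ) : Prop where
  two_le_n : 2 ≤ n
  two_le_K : 2 ≤ K
  one_le_β : 1 ≤ β
  β_lt : 3 ≤ K → β < √(5 / 3)
  b_nonneg : 0 ≤ b
  b_lt_a : b < a
  a_lt_n : a < n
  le_ratio : rlo ≤ b / a
  ratio_le : b / a ≤ rhi
  signal_entropy : Cs * Real.log (n * K) ≤ signal n K β a b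
  mild_growth : Cmg * (K * Real.log K) ≤ Real.log (n * K)

end NodeDPSBM

end

open NodeDPSBM

namespace NodeDPSBM

/-! ### Sums over graphs -/

/-! On the degree envelope the mechanism outputs `σ` with probability at most `min(1, e^{ηd})`,
where `d` is the score of `σ` minus that of the truth. This is at most `e^{θd}` for every `0 ≤ θ ≤
η`, so the risk is bounded by exponential moments of score differences at any tilt below `η`
(`emProb_le_exp`, `expectedMismatch_le_sum`).

At the Chernoff tilt `t⋆` the penalty level makes the moment exact: a pair split by `σ` contributes
`e^{-(1-w)I}`, a merged pair `e^{-wI}`, all others 1 (`sum_sbmProb_exp_tStar`). Jensen's inequality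
transfers this to tilts `x t⋆` with `x ≤ 1`, the exponent being multiplied by `x`.

Combinatorics bounds the weighted number of changed pairs from below (`pairCost_lower_bounds`): by
`N - 1` for every inequivalent balanced labeling and by `3Nm/16` for one with `m` errors, where
`Signal = N I`. A generating function counts labelings by their errors (`sum_exp_errs_le`).
Summation gives risk at most `exp(Q log(nK) - x Signal)` plus the envelope failure.

With `x = min(1, η/t⋆)` three cases remain (`Regime.risk_bound`). At full tilt the sum is at most
`e^{-Signal/2}`. At smaller tilt either the sum is at most `α`, or `Signal ≤ t⋆ s⋆(α)` and the
claimed bound exceeds 1. Hence `δ = 0` suffices.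

The envelope bound is a Chernoff and union bound on degrees. The private mechanism is the Gibbs law
of the McShane extension of the score from the envelope with respect to node distance. -/

theorem mem_pairs {n : ℕ} {e : Fin n × Fin n} : e ∈ pairs n ↔ e.1 < e.2 := by
  simp [pairs]

/-- A sum over all graphs of a product over vertex pairs factorizes. -/
theorem sum_graph_prod {n : ℕ} (f g : Fin n × Fin n → ℝ) :
    (open Classical in ∑ A : SimpleGraph (Fin n), ∏ e ∈ pairs n,
      (if A.Adj e.1 e.2 then f e else g e)) = ∏ e ∈ pairs n, (f e + g e) := by
  classical
  rw [Finset.prod_add]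
  refine Finset.sum_bij' (fun A _ => (pairs n).filter (fun e => A.Adj e.1 e.2))
    (fun s _ => SimpleGraph.fromRel (fun i j => (i, j) ∈ s)) ?_ ?_ ?_ ?_ ?_
  · intro A _
    simp
  · intro s _
    simp
  · intro A _
    ext i j
    simp only [SimpleGraph.fromRel_adj, Finset.mem_filter, mem_pairs]
    constructor
    · rintro ⟨_, h | h⟩
      · exact h.2
      · exact h.2.symm
    · intro h
      refine ⟨h.ne, ?_⟩
      rcases lt_or_gt_of_ne h.ne with h' | h'
      · exact Or.inl ⟨h', h⟩
      · exact Or.inr ⟨h', h.symm⟩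
  · intro s hs
    rw [Finset.mem_powerset] at hs
    ext e
    simp only [Finset.mem_filter, mem_pairs, SimpleGraph.fromRel_adj]
    constructor
    · rintro ⟨h, _, h' | h'⟩
      · exact h'
      · have := mem_pairs.1 (hs h')
        exact absurd this (lt_asymm h)
    · intro h
      have := mem_pairs.1 (hs h)
      exact ⟨this, this.ne, Or.inl h⟩
  · intro A _
    rw [Finset.prod_ite]
    congr 1
    refine Finset.prod_congr ?_ fun _ _ => rfl
    ext e
    simp only [Finset.mem_filter, Finset.mem_sdiff]
    tauto

theorem edgeProb_nonneg {n K : ℕ} {a b : ℝ} (ha : 0 ≤ a) (hb : 0 ≤ b) (σ₀ : Fin n → Fin K)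
    (i j : Fin n) : 0 ≤ edgeProb a b σ₀ i j := by
  unfold edgeProb
  split_ifs <;> positivity

theorem edgeProb_le {n K : ℕ} {a b : ℝ} (hab : b ≤ a) (σ₀ : Fin n → Fin K)
    (i j : Fin n) : edgeProb a b σ₀ i j ≤ a / n := by
  unfold edgeProb
  split_ifs
  · rfl
  · gcongr

theorem edgeProb_le_one {n K : ℕ} {a b : ℝ} (hab : b ≤ a) (han : a ≤ n)
    (σ₀ : Fin n → Fin K) (i j : Fin n) : edgeProb a b σ₀ i j ≤ 1 :=
  (edgeProb_le hab σ₀ i j).trans (div_le_one_of_le₀ han (Nat.cast_nonneg n))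

theorem sbmProb_nonneg {n K : ℕ} {a b : ℝ} (hb : 0 ≤ b) (hab : b ≤ a) (han : a ≤ n)
    (σ₀ : Fin n → Fin K) (A : SimpleGraph (Fin n)) : 0 ≤ sbmProb a b σ₀ A := by
  refine Finset.prod_nonneg fun e _ => ?_
  split_ifs
  · exact edgeProb_nonneg (hb.trans hab) hb σ₀ _ _
  · linarith [edgeProb_le_one hab han σ₀ e.1 e.2]

/-- Exponential moments of edge sums under the block model. -/
theorem sum_sbmProb_mul_prod {n K : ℕ} (a b : ℝ) (σ₀ : Fin n → Fin K)
    (f g : Fin n × Fin n → ℝ) :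
    (open Classical in ∑ A : SimpleGraph (Fin n), sbmProb a b σ₀ A * ∏ e ∈ pairs n,
      (if A.Adj e.1 e.2 then f e else g e)) =
    ∏ e ∈ pairs n, (edgeProb a b σ₀ e.1 e.2 * f e + (1 - edgeProb a b σ₀ e.1 e.2) * g e) := by
  classical
  rw [← sum_graph_prod]
  refine Finset.sum_congr rfl fun A _ => ?_
  unfold sbmProb
  rw [← Finset.prod_mul_distrib]
  refine Finset.prod_congr rfl fun e _ => ?_
  split_ifs <;> rfl

theorem sum_sbmProb {n K : ℕ} (a b : ℝ) (σ₀ : Fin n → Fin K) :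
    (open Classical in ∑ A : SimpleGraph (Fin n), sbmProb a b σ₀ A) = 1 := by
  classical
  have h := sum_sbmProb_mul_prod a b σ₀ (fun _ => 1) (fun _ => 1)
  simpa using h

theorem sum_not_mem_sbmProb {n K : ℕ} (a b : ℝ) (σ₀ : Fin n → Fin K)
    (H : Set (SimpleGraph (Fin n))) :
    (open Classical in ∑ A ∈ Finset.univ.filter (fun A : SimpleGraph (Fin n) => A ∉ H),
      sbmProb a b σ₀ A) = 1 - sbmMeasure a b σ₀ H := by
  classical
  have h := Finset.sum_filter_add_sum_filter_not Finset.univ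
    (fun A : SimpleGraph (Fin n) => A ∈ H) (sbmProb a b σ₀)
  rw [sum_sbmProb] at h
  unfold sbmMeasure
  linarith

/-! ### The degree envelope -/

/-- The increasing pair with entries `v` and `j`. -/
def sortedPair {n : ℕ} (v j : Fin n) : Fin n × Fin n := (min v j, max v j)

/-- The vertex pairs that contain `v`. -/
def pairsAt {n : ℕ} (v : Fin n) : Finset (Fin n × Fin n) :=
  (pairs n).filter (fun e => e.1 = v ∨ e.2 = v)

theorem card_pairsAt_le {n : ℕ} (v : Fin n) : (pairsAt v).card ≤ n := by
  have : pairsAt v ⊆ Finset.univ.image (sortedPair v) := by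
    rintro ⟨i, j⟩ h
    simp only [pairsAt, Finset.mem_filter, mem_pairs] at h
    rw [Finset.mem_image]
    rcases h with ⟨h, rfl | rfl⟩
    · exact ⟨j, Finset.mem_univ _, by simp [sortedPair, h.le]⟩
    · exact ⟨i, Finset.mem_univ _, by simp [sortedPair, h.le]⟩
  calc (pairsAt v).card ≤ _ := Finset.card_le_card this
    _ ≤ _ := Finset.card_image_le
    _ = n := by simp

open Classical in
theorem degree_le_card_filter_pairsAt {n : ℕ} (A : SimpleGraph (Fin n)) (v : Fin n) :
    A.degree v ≤ ((pairsAt v).filter (fun e => A.Adj e.1 e.2)).card := by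
  rw [← SimpleGraph.card_neighborFinset_eq_degree]
  refine Finset.card_le_card_of_injOn (sortedPair v) ?_ ?_
  · intro j hj
    have hj : A.Adj v j := by simpa using hj
    simp only [pairsAt, Finset.coe_filter, Finset.mem_filter, mem_pairs, Set.mem_ofPred_eq,
      sortedPair]
    rcases lt_or_gt_of_ne hj.ne with h | h
    · simp [h.le, h, hj]
    · simp [h.le, h, hj.symm]
  · intro j hj k hk h
    have hj : A.Adj v j := by simpa using hj
    have hk : A.Adj v k := by simpa using hk
    have h1 := hj.ne
    have h2 := hk.ne
    simp only [sortedPair, Prod.mk.injEq] at h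
    rcases lt_or_gt_of_ne h1 with h1 | h1 <;> rcases lt_or_gt_of_ne h2 with h2 | h2
    · simpa [h1.le, h2.le] using h.2
    · simp only [min_eq_left h1.le, min_eq_right h2.le] at h
      exact absurd h.1 h2.ne'
    · simp only [min_eq_right h1.le, min_eq_left h2.le] at h
      exact absurd h.1 h1.ne
    · simpa [h1.le, h2.le] using h.1

/-- Exponential moment bound for the degree of a vertex. -/
theorem sum_sbmProb_exp_degree_le {n K : ℕ} {a b : ℝ} (hn : 0 < n) (hb : 0 ≤ b) (hab : b ≤ a)
    (han : a ≤ n) (σ₀ : Fin n → Fin K) (v : Fin n) :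
    (open Classical in ∑ A : SimpleGraph (Fin n), sbmProb a b σ₀ A * Real.exp (A.degree v)) ≤
      Real.exp (2 * a) := by
  classical
  have hn' : (0 : ℝ) < n := by exact_mod_cast hn
  have ha : 0 ≤ a := hb.trans hab
  calc (∑ A : SimpleGraph (Fin n), sbmProb a b σ₀ A * Real.exp (A.degree v))
      ≤ ∑ A : SimpleGraph (Fin n), sbmProb a b σ₀ A * ∏ e ∈ pairs n,
        (if A.Adj e.1 e.2 then (if e.1 = v ∨ e.2 = v then Real.exp 1 else 1) else 1) := by
        refine Finset.sum_le_sum fun A _ =>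
          mul_le_mul_of_nonneg_left ?_ (sbmProb_nonneg hb hab han σ₀ A)
        have : (∏ e ∈ pairs n, (if A.Adj e.1 e.2 then
            (if e.1 = v ∨ e.2 = v then Real.exp 1 else 1) else 1)) =
            Real.exp (((pairsAt v).filter (fun e => A.Adj e.1 e.2)).card) := by
          rw [← Finset.prod_filter, ← Finset.prod_filter, Finset.prod_const, ← Real.exp_nat_mul,
            mul_one, Finset.filter_comm]
          rfl
        rw [this]
        exact Real.exp_le_exp.2 (by exact_mod_cast degree_le_card_filter_pairsAt A v)
    _ = ∏ e ∈ pairs n, (edgeProb a b σ₀ e.1 e.2 * (if e.1 = v ∨ e.2 = v then Real.exp 1 else 1)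
          + (1 - edgeProb a b σ₀ e.1 e.2) * 1) :=
        sum_sbmProb_mul_prod a b σ₀
          (fun e => if e.1 = v ∨ e.2 = v then Real.exp 1 else 1) (fun _ => 1)
    _ ≤ ∏ e ∈ pairs n, (if e.1 = v ∨ e.2 = v then Real.exp (2 * (a / n)) else 1) := by
        refine Finset.prod_le_prod (fun e _ => ?_) fun e _ => ?_
        · have h0 := edgeProb_nonneg ha hb σ₀ e.1 e.2
          have h1 := edgeProb_le_one hab han σ₀ e.1 e.2
          have : 0 ≤ 1 - edgeProb a b σ₀ e.1 e.2 := by linarith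
          positivity
        · have h0 := edgeProb_nonneg ha hb σ₀ e.1 e.2
          have h1 := edgeProb_le hab σ₀ e.1 e.2
          split_ifs
          -- With `p` the edge probability, `1 + p(e - 1) ≤ 1 + 2a/n ≤ e^{2a/n}`.
          · have h2 := Real.exp_one_lt_d9
            have h3 := Real.add_one_le_exp (2 * (a / n))
            nlinarith
          · linarith
    _ = Real.exp (2 * (a / n)) ^ (pairsAt v).card := by
        rw [← Finset.prod_filter, Finset.prod_const]
        rfl
    _ ≤ Real.exp (2 * a) := by
        rw [← Real.exp_nat_mul]
        refine Real.exp_le_exp.2 ?_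
        have h1 : ((pairsAt v).card : ℝ) ≤ n := by exact_mod_cast card_pairsAt_le v
        calc ((pairsAt v).card : ℝ) * (2 * (a / n)) ≤ n * (2 * (a / n)) := by gcongr
          _ = 2 * a := by field_simp

/-- The block model lies in the degree envelope with high probability. -/
theorem le_sbmMeasure_envelope {n K : ℕ} {a b C : ℝ} (hC : 26 ≤ C) (hn : 2 ≤ n) (hb : 0 ≤ b)
    (hab : b ≤ a) (han : a ≤ n) (σ₀ : Fin n → Fin K) :
    1 - Real.exp (-10 * (a + Real.log n)) ≤ sbmMeasure a b σ₀ (envelope n C a) := by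
  classical
  have ha : 0 ≤ a := hb.trans hab
  have hn' : (0 : ℝ) < n := by positivity
  have hL : 0 ≤ Real.log n := Real.log_natCast_nonneg n
  have : Nonempty (Fin n) := ⟨⟨0, by omega⟩⟩
  set D := C * max a (Real.log n) with hD
  -- A maximum is at least half the sum, whence `13 = 26/2`. The surplus over 10 pays for `2a` from
  -- the moment bound and `log n` from the union over vertices.
  have hDge : 13 * (a + Real.log n) ≤ D := by
    have h1 := le_max_left a (Real.log n)
    have h2 := le_max_right a (Real.log n)
    nlinarith
  suffices h : (∑ A ∈ Finset.univ.filter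
      (fun A : SimpleGraph (Fin n) => A ∉ envelope n C a), sbmProb a b σ₀ A) ≤
      Real.exp (-10 * (a + Real.log n)) by
    rw [sum_not_mem_sbmProb] at h
    linarith
  calc (∑ A ∈ Finset.univ.filter
      (fun A : SimpleGraph (Fin n) => A ∉ envelope n C a), sbmProb a b σ₀ A)
      ≤ ∑ A : SimpleGraph (Fin n), sbmProb a b σ₀ A *
          ∑ v, Real.exp (-D) * Real.exp (A.degree v) := by
        rw [Finset.sum_filter]
        refine Finset.sum_le_sum fun A _ => ?_
        have hp := sbmProb_nonneg hb hab han σ₀ A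
        by_cases hA : A ∉ envelope n C a
        · rw [if_pos hA]
          refine le_mul_of_one_le_right hp ?_
          obtain ⟨v, hv⟩ := A.exists_maximal_degree_vertex
          have hv' : D < A.degree v := by
            have : ¬ ((A.maxDegree : ℝ) ≤ D) := fun h => hA (by
              simp only [envelope, Set.mem_ofPred_eq]
              convert h)
            rw [← hv]
            exact not_le.1 this
          calc (1 : ℝ) ≤ Real.exp (-D) * Real.exp (A.degree v) := by
                rw [← Real.exp_add]
                exact Real.one_le_exp (by linarith)
            _ ≤ _ := Finset.single_le_sum
              (f := fun v => Real.exp (-D) * Real.exp (A.degree v))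
              (fun _ _ => by positivity) (Finset.mem_univ v)
        · rw [if_neg hA]
          exact mul_nonneg hp (Finset.sum_nonneg fun _ _ => by positivity)
    _ = ∑ v, Real.exp (-D) *
          ∑ A : SimpleGraph (Fin n), sbmProb a b σ₀ A * Real.exp (A.degree v) := by
        simp only [Finset.mul_sum]
        rw [Finset.sum_comm]
        exact Finset.sum_congr rfl fun v _ => Finset.sum_congr rfl fun A _ => by ring
    _ ≤ ∑ _v : Fin n, Real.exp (-D) * Real.exp (2 * a) := by
        refine Finset.sum_le_sum fun v _ => ?_
        gcongr
        convert sum_sbmProb_exp_degree_le (by omega) hb hab han σ₀ v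
    _ = Real.exp (Real.log n + (-D + 2 * a)) := by
        rw [Finset.sum_const, Finset.card_univ, Fintype.card_fin, nsmul_eq_mul, Real.exp_add,
          Real.exp_log hn', Real.exp_add]
    _ ≤ _ := Real.exp_le_exp.2 (by linarith)

/-! ### Existence of the private estimator -/

open Classical in
theorem card_filter_pairsAt_le_degree {n : ℕ} (A : SimpleGraph (Fin n)) (v : Fin n) :
    ((pairsAt v).filter (fun e => A.Adj e.1 e.2)).card ≤ A.degree v := by
  rw [← SimpleGraph.card_neighborFinset_eq_degree]
  refine Finset.card_le_card_of_injOn (fun e => if e.1 = v then e.2 else e.1) ?_ ?_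
  · rintro ⟨i, j⟩ h
    simp only [pairsAt, Finset.coe_filter, Finset.mem_filter, mem_pairs, Set.mem_ofPred_eq] at h
    obtain ⟨⟨h1, h2⟩, h3⟩ := h
    rcases h2 with rfl | rfl
    · simpa using h3
    · simpa [h1.ne] using h3.symm
  · rintro ⟨i, j⟩ h ⟨k, l⟩ h' heq
    simp only [pairsAt, Finset.coe_filter, Finset.mem_filter, mem_pairs, Set.mem_ofPred_eq] at h h'
    obtain ⟨⟨h1, h2⟩, -⟩ := h
    obtain ⟨⟨h1', h2'⟩, -⟩ := h'
    simp only at heq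
    split_ifs at heq with h3 h4 h4
    · simp [h3, h4, heq]
    · have : l = v := by tauto
      rw [Prod.mk.injEq]
      subst h3 this heq
      exact absurd h1 (lt_asymm h1')
    · have : j = v := by tauto
      subst h4 this heq
      exact absurd h1 (lt_asymm h1')
    · have e1 : l = v := by tauto
      have e2 : j = v := by tauto
      simp [e1, e2, heq]

/-- The graphs `A` and `A'` have the same edges outside the vertex set `V`. -/
def AgreeOff {n : ℕ} (V : Finset (Fin n)) (A A' : SimpleGraph (Fin n)) : Prop :=
  ∀ i j : Fin n, i ∉ V → j ∉ V → (A.Adj i j ↔ A'.Adj i j)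

/-- The score is Lipschitz in the node distance on the degree envelope. -/
theorem score_le_score_add {n K : ℕ} {C a lam : ℝ} {A A' : SimpleGraph (Fin n)}
    {V : Finset (Fin n)} (hA : A ∈ envelope n C a) (hC : 0 ≤ C * max a (Real.log n))
    (h : AgreeOff V A A') (σ : Fin n → Fin K) :
    score lam A σ ≤ score lam A' σ + sens n C a * V.card := by
  classical
  have hdeg : ∀ v, (((pairsAt v).filter (fun e => A.Adj e.1 e.2)).card : ℝ) ≤
      C * max a (Real.log n) := by
    intro v
    have h1 := (card_filter_pairsAt_le_degree A v).trans (A.degree_le_maxDegree v)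
    have h2 : (A.maxDegree : ℝ) ≤ C * max a (Real.log n) := by
      simp only [envelope, Set.mem_ofPred_eq] at hA
      convert hA
    exact le_trans (by exact_mod_cast h1) h2
  have hsub : (pairs n).filter (fun e => A.Adj e.1 e.2 ∧ ¬ A'.Adj e.1 e.2) ⊆
      V.biUnion (fun v => (pairsAt v).filter (fun e => A.Adj e.1 e.2)) := by
    intro e he
    simp only [Finset.mem_filter, Finset.mem_biUnion, pairsAt] at he ⊢
    by_contra! hc
    refine he.2.2 ((h e.1 e.2 ?_ ?_).1 he.2.1)
    · exact fun hv => hc _ hv ⟨he.1, Or.inl rfl⟩ he.2.1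
    · exact fun hv => hc _ hv ⟨he.1, Or.inr rfl⟩ he.2.1
  have hcard : (((pairs n).filter (fun e => A.Adj e.1 e.2 ∧ ¬ A'.Adj e.1 e.2)).card : ℝ) ≤
      V.card * (C * max a (Real.log n)) := by
    calc (((pairs n).filter (fun e => A.Adj e.1 e.2 ∧ ¬ A'.Adj e.1 e.2)).card : ℝ)
        ≤ ∑ v ∈ V, (((pairsAt v).filter (fun e => A.Adj e.1 e.2)).card : ℝ) := by
          exact_mod_cast (Finset.card_le_card hsub).trans Finset.card_biUnion_le
      _ ≤ ∑ v ∈ V, C * max a (Real.log n) := Finset.sum_le_sum fun v _ => hdeg v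
      _ = _ := by rw [Finset.sum_const, nsmul_eq_mul]
  -- The penalty cancels, and only edges of `A` missing in `A'` raise the difference; hence degrees
  -- of `A` alone matter.
  have hdiff : score lam A σ - score lam A' σ ≤
      ((pairs n).filter (fun e => A.Adj e.1 e.2 ∧ ¬ A'.Adj e.1 e.2)).card := by
    unfold score
    rw [← Finset.sum_sub_distrib, Finset.card_filter, Nat.cast_sum]
    refine Finset.sum_le_sum fun e _ => ?_
    by_cases h1 : A.Adj e.1 e.2 <;> by_cases h2 : A'.Adj e.1 e.2 <;>
      by_cases h3 : σ e.1 = σ e.2 <;> simp [h1, h2, h3]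
  unfold sens
  have : 0 ≤ (V.card : ℝ) * (C * max a (Real.log n)) := by positivity
  nlinarith

open Classical in
/-- The pairs of a graph in the envelope and a vertex set off which it agrees with `A`. -/
noncomputable def extCandidates (n : ℕ) (C a : ℝ) (A : SimpleGraph (Fin n)) :
    Finset (SimpleGraph (Fin n) × Finset (Fin n)) :=
  Finset.univ.filter (fun p => p.1 ∈ envelope n C a ∧ AgreeOff p.2 A p.1)

theorem mem_extCandidates {n : ℕ} {C a : ℝ} {A : SimpleGraph (Fin n)}
    {p : SimpleGraph (Fin n) × Finset (Fin n)} :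
    p ∈ extCandidates n C a A ↔ p.1 ∈ envelope n C a ∧ AgreeOff p.2 A p.1 := by
  simp [extCandidates]

theorem extCandidates_nonempty {n : ℕ} {C a : ℝ} (hC : 0 ≤ C * max a (Real.log n))
    (A : SimpleGraph (Fin n)) : (extCandidates n C a A).Nonempty := by
  classical
  -- The empty graph has degree 0, and agreement off the full vertex set is vacuous.
  refine ⟨(⊥, Finset.univ), mem_extCandidates.2 ⟨?_, fun i j hi _ => absurd (Finset.mem_univ i) hi⟩⟩
  simp only [envelope, Set.mem_ofPred_eq]
  convert hC
  have h : (⊥ : SimpleGraph (Fin n)).maxDegree ≤ 0 := by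
    apply SimpleGraph.maxDegree_le_of_forall_degree_le
    intro v
    simp
  have : (⊥ : SimpleGraph (Fin n)).maxDegree = 0 := by omega
  rw [Nat.cast_eq_zero]
  convert this

/-- The McShane extension of the score from the degree envelope to all graphs. -/
noncomputable def extScore {n K : ℕ} {C a : ℝ} (hC : 0 ≤ C * max a (Real.log n)) (lam : ℝ)
    (A : SimpleGraph (Fin n)) (σ : Fin n → Fin K) : ℝ :=
  (extCandidates n C a A).inf' (extCandidates_nonempty hC A)
    (fun p => score lam p.1 σ + sens n C a * p.2.card)

/-- The candidate `(A, ∅)` gives one inequality; the Lipschitz bound `score_le_score_add` gives the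
other. -/
theorem extScore_eq_score {n K : ℕ} {C a : ℝ} (hC : 0 ≤ C * max a (Real.log n)) (lam : ℝ)
    {A : SimpleGraph (Fin n)} (hA : A ∈ envelope n C a) (σ : Fin n → Fin K) :
    extScore hC lam A σ = score lam A σ := by
  refine le_antisymm ?_ ?_
  · refine (Finset.inf'_le (b := (A, (∅ : Finset (Fin n)))) _ ?_).trans (by simp)
    exact mem_extCandidates.2 ⟨hA, fun _ _ _ _ => Iff.rfl⟩
  · refine Finset.le_inf' _ _ fun p hp => ?_
    exact score_le_score_add hA hC (mem_extCandidates.1 hp).2 σ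

theorem NodeAdjacent.symm {n : ℕ} {A A' : SimpleGraph (Fin n)} (h : NodeAdjacent A A') :
    NodeAdjacent A' A := by
  obtain ⟨h1, v, h2⟩ := h
  exact ⟨h1.symm, v, fun i j hi hj => (h2 i j hi hj).symm⟩

/-- Adding the changed vertex to the exceptional set of a candidate for `A'` makes it a candidate
for `A`, at the price of one sensitivity unit. -/
theorem extScore_le_of_nodeAdjacent {n K : ℕ} {C a : ℝ} (hC : 0 ≤ C * max a (Real.log n))
    (lam : ℝ) {A A' : SimpleGraph (Fin n)} (h : NodeAdjacent A A') (σ : Fin n → Fin K) :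
    extScore hC lam A σ ≤ extScore hC lam A' σ + sens n C a := by
  classical
  have hs : 0 ≤ sens n C a := by
    unfold sens
    linarith
  obtain ⟨-, v, h⟩ := h
  rw [← sub_le_iff_le_add]
  refine Finset.le_inf' _ _ fun p hp => ?_
  obtain ⟨h1, h2⟩ := mem_extCandidates.1 hp
  rw [sub_le_iff_le_add]
  refine (Finset.inf'_le (b := (p.1, insert v p.2)) _ ?_).trans ?_
  · refine mem_extCandidates.2 ⟨h1, fun i j hi hj => ?_⟩
    simp only [Finset.mem_insert, not_or] at hi hj
    exact (h i j hi.1 hj.1).trans (h2 i j hi.2 hj.2)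
  · have : ((insert v p.2).card : ℝ) ≤ p.2.card + 1 := by
      exact_mod_cast Finset.card_insert_le v p.2
    simp only
    nlinarith

/-! ### Gibbs distributions on a finite set -/

open Classical in
/-- The Gibbs weight on a finite set `B` with log-weights `W`. -/
noncomputable def gibbs {Y : Type*} [Fintype Y] (B : Set Y) (W : Y → ℝ) (y : Y) : ℝ :=
  (if y ∈ B then Real.exp (W y) else 0) /
    ∑ z ∈ Finset.univ.filter (fun z => z ∈ B), Real.exp (W z)

section Gibbs

variable {Y : Type*} [Fintype Y] {B : Set Y} {W W' : Y → ℝ}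

theorem gibbs_nonneg (y : Y) : 0 ≤ gibbs B W y := by
  classical
  unfold gibbs
  refine div_nonneg ?_ (Finset.sum_nonneg fun _ _ => (Real.exp_pos _).le)
  split_ifs
  · exact (Real.exp_pos _).le
  · rfl

theorem gibbs_eq_zero {y : Y} (hy : y ∉ B) : gibbs B W y = 0 := by
  simp [gibbs, hy]

open Classical in
theorem gibbs_denom_pos (hB : B.Nonempty) :
    0 < ∑ z ∈ Finset.univ.filter (fun z => z ∈ B), Real.exp (W z) := by
  obtain ⟨y, hy⟩ := hB
  exact Finset.sum_pos (fun _ _ => Real.exp_pos _) ⟨y, by simpa using hy⟩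

theorem sum_gibbs (hB : B.Nonempty) : ∑ y, gibbs B W y = 1 := by
  classical
  unfold gibbs
  rw [← Finset.sum_div, ← Finset.sum_filter]
  exact div_self (gibbs_denom_pos hB).ne'

/-- Comparing with a reference point bounds the Gibbs weight. -/
theorem gibbs_le_exp_sub {y₀ : Y} (hy₀ : y₀ ∈ B) (y : Y) :
    gibbs B W y ≤ Real.exp (W y - W y₀) := by
  classical
  have hd := gibbs_denom_pos (W := W) ⟨y₀, hy₀⟩
  have h0 : Real.exp (W y₀) ≤ ∑ z ∈ Finset.univ.filter (fun z => z ∈ B), Real.exp (W z) :=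
    Finset.single_le_sum (f := fun z => Real.exp (W z)) (fun _ _ => (Real.exp_pos _).le)
      (by simpa using hy₀)
  unfold gibbs
  rw [Real.exp_sub]
  gcongr
  split_ifs
  · rfl
  · exact (Real.exp_pos _).le

theorem gibbs_le_one (y : Y) : gibbs B W y ≤ 1 := by
  by_cases hy : y ∈ B
  · simpa using gibbs_le_exp_sub (W := W) hy y
  · rw [gibbs_eq_zero hy]
    exact zero_le_one

/-- One factor `e^c` comes from the numerator, the other from the normalizing sum. -/
theorem gibbs_le_mul {c : ℝ} (hB : B.Nonempty) (h : ∀ y, W y ≤ W' y + c)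
    (h' : ∀ y, W' y ≤ W y + c) (y : Y) :
    gibbs B W y ≤ Real.exp (2 * c) * gibbs B W' y := by
  classical
  have hd := gibbs_denom_pos (W := W) hB
  have hd' := gibbs_denom_pos (W := W') hB
  have hle : (∑ z ∈ Finset.univ.filter (fun z => z ∈ B), Real.exp (W' z)) ≤
      Real.exp c * ∑ z ∈ Finset.univ.filter (fun z => z ∈ B), Real.exp (W z) := by
    rw [Finset.mul_sum]
    refine Finset.sum_le_sum fun z _ => ?_
    rw [← Real.exp_add]
    exact Real.exp_le_exp.2 (by linarith [h' z])
  by_cases hy : y ∈ B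
  · unfold gibbs
    rw [if_pos hy, if_pos hy, ← mul_div_assoc, div_le_div_iff₀ hd hd']
    calc Real.exp (W y) * ∑ z ∈ Finset.univ.filter (fun z => z ∈ B), Real.exp (W' z)
        ≤ (Real.exp c * Real.exp (W' y)) *
          (Real.exp c * ∑ z ∈ Finset.univ.filter (fun z => z ∈ B), Real.exp (W z)) := by
          gcongr
          rw [← Real.exp_add]
          exact Real.exp_le_exp.2 (by linarith [h y])
      _ = _ := by
          rw [two_mul, Real.exp_add]
          ring
  · rw [gibbs_eq_zero hy, gibbs_eq_zero hy, mul_zero]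

/-- The Gibbs distribution as a probability mass function. -/
noncomputable def gibbsPMF (hB : B.Nonempty) (W : Y → ℝ) : PMF Y :=
  PMF.ofFintype (fun y => ENNReal.ofReal (gibbs B W y)) (by
    rw [← ENNReal.ofReal_sum_of_nonneg fun y _ => gibbs_nonneg y, sum_gibbs hB,
      ENNReal.ofReal_one])

end Gibbs

theorem emProb_eq_gibbs {n K : ℕ} (β a b w C ε : ℝ) (A : SimpleGraph (Fin n))
    (σ : Fin n → Fin K) :
    emProb β a b w C ε A σ = gibbs (balanced n K β)
      (fun τ => ε / 2 / (2 * sens n C a) * score (penalty n K a b w) A τ) σ := rfl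

/-- The private estimator exists. -/
theorem exists_isPrivateEstimator {n K : ℕ} {β a b w C ε : ℝ} (hn : 2 ≤ n) (hC : 0 < C)
    (hε : 0 < ε) (hB : (balanced n K β).Nonempty) :
    ∃ M : SimpleGraph (Fin n) → PMF (Fin n → Fin K), IsPrivateEstimator β a b w C ε M := by
  classical
  have hlog : 0 < Real.log n := Real.log_pos (by exact_mod_cast hn)
  have hpos : 0 < C * max a (Real.log n) := mul_pos hC (lt_max_of_lt_right hlog)
  have hs : 0 < sens n C a := by
    unfold sens
    linarith
  have hc : 0 ≤ ε / 2 / (2 * sens n C a) := by positivity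
  have hcs : ε / 2 / (2 * sens n C a) * sens n C a = ε / 4 := by
    field_simp
    ring
  refine ⟨fun A => gibbsPMF hB
    (fun τ => ε / 2 / (2 * sens n C a) * extScore hpos.le (penalty n K a b w) A τ), ?_, ?_, ?_⟩
  · intro A A' hAA' S
    -- Log-weights move by `ε/4`, so probabilities change by a factor of at most `e^{ε/2}`, within
    -- the budget.
    have key : ∀ {A A' : SimpleGraph (Fin n)}, NodeAdjacent A A' → ∀ τ : Fin n → Fin K,
        ε / 2 / (2 * sens n C a) * extScore hpos.le (penalty n K a b w) A τ ≤
        ε / 2 / (2 * sens n C a) * extScore hpos.le (penalty n K a b w) A' τ + ε / 4 := by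
      intro A A' h τ
      have := mul_le_mul_of_nonneg_left
        (extScore_le_of_nodeAdjacent hpos.le (penalty n K a b w) h τ) hc
      rwa [mul_add, hcs] at this
    rw [PMF.toOuterMeasure_apply_fintype, PMF.toOuterMeasure_apply_fintype, Finset.mul_sum]
    refine Finset.sum_le_sum fun σ _ => ?_
    by_cases hσ : σ ∈ S
    · rw [Set.indicator_of_mem hσ, Set.indicator_of_mem hσ]
      unfold gibbsPMF
      rw [PMF.ofFintype_apply, PMF.ofFintype_apply, ← ENNReal.ofReal_mul (Real.exp_pos _).le]
      refine ENNReal.ofReal_le_ofReal ((gibbs_le_mul hB (key hAA') (key hAA'.symm) σ).trans ?_)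
      refine mul_le_mul_of_nonneg_right (Real.exp_le_exp.2 ?_) (gibbs_nonneg _)
      linarith
    · rw [Set.indicator_of_notMem hσ]
      exact zero_le
  · intro A σ hσ
    by_contra h
    rw [PMF.mem_support_iff] at hσ
    refine hσ ?_
    unfold gibbsPMF
    rw [PMF.ofFintype_apply, gibbs_eq_zero h, ENNReal.ofReal_zero]
  · intro A hA σ
    rw [emProb_eq_gibbs]
    unfold gibbsPMF
    rw [PMF.ofFintype_apply]
    simp only [extScore_eq_score hpos.le _ hA]

/-! ### The exponential moment of a score difference -/

/-- The pairs that `σ` puts together and `τ` separates. -/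
def splitPairs {n K : ℕ} (σ τ : Fin n → Fin K) : Finset (Fin n × Fin n) :=
  (pairs n).filter (fun e => σ e.1 = σ e.2 ∧ τ e.1 ≠ τ e.2)

/-- The weight in the penalty level, with the convention `1 / 2` for two classes. -/
noncomputable def effWeight (K : ℕ) (w : ℝ) : ℝ := if K = 2 then 1 / 2 else w

theorem effWeight_mem {K : ℕ} {w : ℝ} (h0 : 0 ≤ w) (h1 : w ≤ 1) :
    0 ≤ effWeight K w ∧ effWeight K w ≤ 1 := by
  unfold effWeight
  split_ifs <;> constructor <;> linarith

/-- The effective number of pairs in the exponential moment of a score difference. -/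
noncomputable def pairCost {n K : ℕ} (w : ℝ) (σ₀ σ : Fin n → Fin K) : ℝ :=
  (1 - effWeight K w) * (splitPairs σ₀ σ).card + effWeight K w * (splitPairs σ σ₀).card

section Parameters

variable {n K : ℕ} {a b : ℝ}

theorem one_lt_tilt_ratio (hb : 0 < b) (hab : b < a) (han : a < n) :
    1 < a * (1 - b / n) / (b * (1 - a / n)) := by
  have hn : 0 < (n : ℝ) := by linarith
  have hp : a / n < 1 := (div_lt_one hn).2 han
  have hq : b / n < a / n := by gcongr
  have hd : 0 < b * (1 - a / n) := mul_pos hb (by linarith)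
  rw [one_lt_div hd]
  have h1 : b * (a / n) = a * (b / n) := by ring
  nlinarith

theorem tStar_pos (hb : 0 < b) (hab : b < a) (han : a < n) : 0 < tStar n a b := by
  have := Real.log_pos (one_lt_tilt_ratio hb hab han)
  unfold tStar
  linarith

theorem exp_tStar_sq (hb : 0 < b) (hab : b < a) (han : a < n) :
    Real.exp (tStar n a b) * Real.exp (tStar n a b) = a * (1 - b / n) / (b * (1 - a / n)) := by
  rw [← Real.exp_add]
  unfold tStar
  rw [← add_mul, show (1 / 2 + 1 / 2 : ℝ) = 1 by norm_num, one_mul,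
    Real.exp_log (by linarith [one_lt_tilt_ratio hb hab han])]

theorem tilted_pos_within (ha : 0 < a) (han : a < n) (t : ℝ) :
    0 < a / n * Real.exp t + 1 - a / n := by
  have hn : 0 < (n : ℝ) := by linarith
  have hp : a / n < 1 := (div_lt_one hn).2 han
  have : 0 < a / n * Real.exp t := by positivity
  linarith

/-- At the Chernoff tilt, the two log-moment generating functions add up to `-I`. -/
theorem log_tilted_add_log_tilted (hb : 0 < b) (hab : b < a) (han : a < n) :
    Real.log (a / n * Real.exp (-tStar n a b) + 1 - a / n) +
      Real.log (b / n * Real.exp (tStar n a b) + 1 - b / n) = -renyiI n a b := by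
  have hn : 0 < (n : ℝ) := by linarith
  have ha : 0 < a := hb.trans hab
  have hp : a / n < 1 := (div_lt_one hn).2 han
  have hq : b / n < 1 := (div_lt_one hn).2 (hab.trans han)
  have hp0 : 0 < a / n := by positivity
  have hq0 : 0 < b / n := by positivity
  have hP := tilted_pos_within ha han (-tStar n a b)
  have hQ := tilted_pos_within hb (hab.trans han) (tStar n a b)
  have hsq := exp_tStar_sq hb hab han
  rw [← Real.log_mul hP.ne' hQ.ne']
  unfold renyiI
  set p := a / n with hpdef
  set q := b / n with hqdef
  set u := Real.exp (tStar n a b) with hu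
  have hu0 : 0 < u := Real.exp_pos _
  set s := √(p * q)
  set r := √((1 - p) * (1 - q))
  have hs : s * s = p * q := Real.mul_self_sqrt (by positivity)
  have hr0 : 0 < (1 - p) * (1 - q) := mul_pos (by linarith) (by linarith)
  have hr : r * r = (1 - p) * (1 - q) := Real.mul_self_sqrt hr0.le
  have hspos : 0 < s := Real.sqrt_pos.2 (by positivity)
  have hrpos : 0 < r := Real.sqrt_pos.2 hr0
  have hsq' : u * u * (q * (1 - p)) = p * (1 - q) := by
    have h1 : a * (1 - q) / (b * (1 - p)) = p * (1 - q) / (q * (1 - p)) := by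
      rw [hpdef, hqdef]
      field_simp
    rw [hsq, h1]
    exact div_mul_cancel₀ _ (mul_pos hq0 (by linarith)).ne'
  -- At the tilt `t⋆` both cross terms of the product equal the geometric mean `s r`, so the product
  -- is the perfect square `(s + r)²`.
  have hcross : u * (q * (1 - p)) = s * r := by
    have h1 : 0 ≤ u * (q * (1 - p)) :=
      mul_nonneg hu0.le (mul_nonneg hq0.le (by linarith))
    have h2 : (u * (q * (1 - p))) ^ 2 = (s * r) ^ 2 := by
      have e1 : (u * (q * (1 - p))) ^ 2 = (u * u * (q * (1 - p))) * (q * (1 - p)) := by ring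
      have e2 : (s * r) ^ 2 = (s * s) * (r * r) := by ring
      rw [e1, e2, hsq', hs, hr]
      ring
    exact (pow_left_inj₀ h1 (by positivity) two_ne_zero).1 h2
  have hcross' : p * (1 - q) * u⁻¹ = s * r := by
    rw [← hcross, ← hsq']
    field_simp
  have hprod : (p * Real.exp (-tStar n a b) + 1 - p) * (q * u + 1 - q) = (s + r) ^ 2 := by
    rw [Real.exp_neg, ← hu]
    have h1 : u⁻¹ * u = 1 := inv_mul_cancel₀ hu0.ne'
    calc (p * u⁻¹ + 1 - p) * (q * u + 1 - q)
        = p * q * (u⁻¹ * u) + p * (1 - q) * u⁻¹ + u * (q * (1 - p)) + (1 - p) * (1 - q) := by ring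
      _ = (s + r) ^ 2 := by
        rw [h1, hcross, hcross', ← hr, mul_one, ← hs]
        ring
  rw [hprod, Real.log_pow]
  push_cast
  ring

/-- Clears the division by `t⋆` and treats `K = 2` and `K ≥ 3` together through `effWeight`. -/
theorem tStar_mul_penalty (hb : 0 < b) (hab : b < a) (han : a < n) (w : ℝ) :
    tStar n a b * penalty n K a b w =
      -effWeight K w * Real.log (a / n * Real.exp (-tStar n a b) + 1 - a / n) +
      (1 - effWeight K w) * Real.log (b / n * Real.exp (tStar n a b) + 1 - b / n) := by
  have ht := (tStar_pos hb hab han).ne'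
  unfold penalty effWeight
  split_ifs
  · simp only
    field_simp
    ring
  · simp only
    field_simp

/-- The exponential moment of a score difference at the Chernoff tilt. -/
theorem sum_sbmProb_exp_tStar (hb : 0 < b) (hab : b < a) (han : a < n) (w : ℝ)
    (σ₀ σ : Fin n → Fin K) :
    (open Classical in ∑ A : SimpleGraph (Fin n), sbmProb a b σ₀ A *
      Real.exp (tStar n a b *
        (score (penalty n K a b w) A σ - score (penalty n K a b w) A σ₀))) =
    Real.exp (-(renyiI n a b * pairCost w σ₀ σ)) := by
  classical
  set t := tStar n a b with ht
  set lam := penalty n K a b w with hlam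
  set W := effWeight K w with hW
  set I := renyiI n a b with hI
  have hlogs := log_tilted_add_log_tilted hb hab han
  have hpen := tStar_mul_penalty (K := K) hb hab han w
  have hP := tilted_pos_within (hb.trans hab) han (-t)
  have hQ := tilted_pos_within hb (hab.trans han) t
  rw [← ht, ← hI] at hlogs
  rw [← ht, ← hlam, ← hW] at hpen
  set dd : Fin n × Fin n → ℝ := fun e =>
    (if σ e.1 = σ e.2 then 1 else 0) - (if σ₀ e.1 = σ₀ e.2 then 1 else 0) with hdd
  have hexp : ∀ A : SimpleGraph (Fin n), Real.exp (t * (score lam A σ - score lam A σ₀)) =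
      ∏ e ∈ pairs n, (if A.Adj e.1 e.2 then Real.exp (t * ((1 - lam) * dd e))
        else Real.exp (t * ((0 - lam) * dd e))) := by
    intro A
    unfold score
    rw [← Finset.sum_sub_distrib, Finset.mul_sum, Real.exp_sum]
    refine Finset.prod_congr rfl fun e _ => ?_
    rw [← mul_sub]
    by_cases h : A.Adj e.1 e.2 <;> simp only [h, if_true, if_false, hdd]
  simp only [hexp]
  have hmom := sum_sbmProb_mul_prod a b σ₀ (fun e => Real.exp (t * ((1 - lam) * dd e)))
    (fun e => Real.exp (t * ((0 - lam) * dd e)))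
  -- The penalty splits the total `-I` of the two log-moments: a split pair receives the share `1 -
  -- W`, a merged pair the share `W`.
  have hfac : ∀ e ∈ pairs n, (edgeProb a b σ₀ e.1 e.2 * Real.exp (t * ((1 - lam) * dd e))
      + (1 - edgeProb a b σ₀ e.1 e.2) * Real.exp (t * ((0 - lam) * dd e))) =
      Real.exp (-(I * ((1 - W) * (if σ₀ e.1 = σ₀ e.2 ∧ σ e.1 ≠ σ e.2 then 1 else 0) +
        W * (if σ e.1 = σ e.2 ∧ σ₀ e.1 ≠ σ₀ e.2 then 1 else 0)))) := by
    intro e _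
    unfold edgeProb
    by_cases h0 : σ₀ e.1 = σ₀ e.2 <;> by_cases h1 : σ e.1 = σ e.2
    · simp [hdd, h0, h1]
    · have e1 : -(I * (1 - W)) = t * lam + Real.log (a / n * Real.exp (-t) + 1 - a / n) := by
        rw [hpen]
        linear_combination (W - 1) * hlogs
      simp only [hdd, h0, h1, ne_eq, not_true, not_false_eq_true, and_self, if_true,
        if_false, mul_one, mul_zero, add_zero]
      rw [e1, Real.exp_add, Real.exp_log hP,
        show t * ((1 - lam) * (0 - 1)) = t * lam + -t by ring,
        show t * ((0 - lam) * (0 - 1)) = t * lam by ring, Real.exp_add]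
      ring
    · have e1 : -(I * W) = -(t * lam) + Real.log (b / n * Real.exp t + 1 - b / n) := by
        rw [hpen]
        linear_combination -W * hlogs
      simp only [hdd, h0, h1, ne_eq, not_true, not_false_eq_true, and_self, if_true,
        if_false, mul_one, mul_zero, zero_add]
      rw [e1, Real.exp_add, Real.exp_log hQ,
        show t * ((1 - lam) * (1 - 0)) = -(t * lam) + t by ring,
        show t * ((0 - lam) * (1 - 0)) = -(t * lam) by ring, Real.exp_add]
      ring
    · simp [hdd, h0, h1]
  rw [hmom, Finset.prod_congr rfl hfac, ← Real.exp_sum]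
  congr 1
  rw [Finset.sum_neg_distrib, ← Finset.mul_sum, Finset.sum_add_distrib, ← Finset.mul_sum,
    ← Finset.mul_sum]
  unfold pairCost splitPairs
  rw [Finset.card_filter, Finset.card_filter]
  push_cast
  rfl

/-- Smaller tilts lose at most a proportional part of the exponent. -/
theorem sum_sbmProb_exp_mul_tStar_le (hb : 0 < b) (hab : b < a) (han : a < n) (w : ℝ)
    (σ₀ σ : Fin n → Fin K) {x : ℝ} (hx0 : 0 ≤ x) (hx1 : x ≤ 1) :
    (open Classical in ∑ A : SimpleGraph (Fin n), sbmProb a b σ₀ A *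
      Real.exp (x * tStar n a b *
        (score (penalty n K a b w) A σ - score (penalty n K a b w) A σ₀))) ≤
    Real.exp (-(x * (renyiI n a b * pairCost w σ₀ σ))) := by
  classical
  -- Jensen's inequality for the concave map `y ↦ y^x`.
  have h := (Real.concaveOn_rpow hx0 hx1).le_map_sum (t := Finset.univ)
    (w := sbmProb a b σ₀) (p := fun A : SimpleGraph (Fin n) => Real.exp (tStar n a b *
        (score (penalty n K a b w) A σ - score (penalty n K a b w) A σ₀)))
    (fun A _ => sbmProb_nonneg hb.le hab.le han.le σ₀ A) (sum_sbmProb a b σ₀)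
    (fun A _ => (Real.exp_pos _).le)
  simp only [smul_eq_mul] at h
  rw [sum_sbmProb_exp_tStar hb hab han w σ₀ σ] at h
  simp only [← Real.exp_mul] at h
  refine le_trans (le_of_eq ?_) (h.trans (le_of_eq ?_))
  · refine Finset.sum_congr rfl fun A _ => ?_
    congr 2
    ring
  · congr 1
    ring

end Parameters

/-! ### Misclassification and separated pairs -/

/-- The number of misclassified vertices under the best matching of the class names. -/
def errs {n K : ℕ} (σ τ : Fin n → Fin K) : ℕ :=
  Finset.univ.inf' Finset.univ_nonempty
    (fun π : Equiv.Perm (Fin K) => hammingDist σ (fun i => π (τ i)))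

section Errs

variable {n K : ℕ} (σ τ : Fin n → Fin K)

theorem errs_le (π : Equiv.Perm (Fin K)) : errs σ τ ≤ hammingDist σ (fun i => π (τ i)) :=
  Finset.inf'_le _ (Finset.mem_univ π)

theorem exists_errs_eq : ∃ π : Equiv.Perm (Fin K),
    errs σ τ = hammingDist σ (fun i => π (τ i)) := by
  obtain ⟨π, -, h⟩ := Finset.exists_mem_eq_inf' Finset.univ_nonempty
    (fun π : Equiv.Perm (Fin K) => hammingDist σ (fun i => π (τ i)))
  exact ⟨π, h⟩

theorem errs_le_errs_swap : errs σ τ ≤ errs τ σ := by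
  obtain ⟨π, h⟩ := exists_errs_eq τ σ
  rw [h]
  refine (errs_le σ τ π.symm).trans (le_of_eq ?_)
  unfold hammingDist
  congr 1
  ext i
  simp only [Finset.mem_filter, Finset.mem_univ, true_and, ne_eq]
  rw [Equiv.eq_symm_apply]
  exact not_congr eq_comm

theorem errs_comm : errs σ τ = errs τ σ :=
  le_antisymm (errs_le_errs_swap σ τ) (errs_le_errs_swap τ σ)

theorem mismatch_eq_errs_div : mismatch σ τ = (errs σ τ : ℝ) / n := by
  refine le_antisymm ?_ ?_
  · obtain ⟨π, h⟩ := exists_errs_eq σ τ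
    rw [h]
    exact Finset.inf'_le _ (Finset.mem_univ π)
  · refine Finset.le_inf' _ _ fun π _ => ?_
    have : (errs σ τ : ℝ) ≤ ((Finset.univ.filter (fun i => σ i ≠ π (τ i))).card : ℝ) := by
      exact_mod_cast errs_le σ τ π
    gcongr

theorem mismatch_le_one : mismatch σ τ ≤ 1 := by
  rw [mismatch_eq_errs_div]
  refine div_le_one_of_le₀ ?_ (Nat.cast_nonneg n)
  have h : hammingDist σ τ ≤ n := by
    simpa using hammingDist_le_card_fintype (x := σ) (y := τ)
  exact_mod_cast (errs_le σ τ 1).trans h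

end Errs

/-- Unordered pairs counted through ordered pairs. -/
theorem two_mul_card_filter_pairs {n : ℕ} (P : Fin n → Fin n → Prop) [DecidableRel P]
    (hs : ∀ i j, P i j → P j i) (hi : ∀ i, ¬ P i i) :
    2 * ((pairs n).filter (fun e => P e.1 e.2)).card =
      ∑ i, (Finset.univ.filter (fun j => P i j)).card := by
  have h1 : ∑ i, (Finset.univ.filter (fun j => P i j)).card =
      (Finset.univ.filter (fun e : Fin n × Fin n => P e.1 e.2)).card := by
    simp only [Finset.card_filter]
    rw [← Finset.univ_product_univ, Finset.sum_product]
  rw [h1, ← Finset.card_filter_add_card_filter_not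
    (s := Finset.univ.filter (fun e : Fin n × Fin n => P e.1 e.2)) (fun e => e.1 < e.2), two_mul]
  congr 1
  · congr 1
    ext e
    simp only [pairs, Finset.mem_filter, Finset.mem_univ, true_and]
    tauto
  · refine Finset.card_bij' (fun e _ => e.swap) (fun e _ => e.swap) ?_ ?_ ?_ ?_
    · rintro ⟨i, j⟩ h
      simp only [pairs, Finset.mem_filter, Finset.mem_univ, true_and, Prod.fst_swap,
        Prod.snd_swap] at h ⊢
      exact ⟨hs _ _ h.2, lt_asymm h.1⟩
    · rintro ⟨i, j⟩ h
      simp only [pairs, Finset.mem_filter, Finset.mem_univ, true_and, Prod.fst_swap,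
        Prod.snd_swap] at h ⊢
      refine ⟨lt_of_le_of_ne (not_lt.1 h.2) ?_, hs _ _ h.1⟩
      rintro rfl
      exact hi _ h.1
    · simp
    · simp

theorem two_mul_card_splitPairs {n K : ℕ} (σ τ : Fin n → Fin K) :
    2 * (splitPairs σ τ).card =
      ∑ i, (Finset.univ.filter (fun j => σ i = σ j ∧ τ i ≠ τ j)).card :=
  two_mul_card_filter_pairs (fun i j => σ i = σ j ∧ τ i ≠ τ j)
    (fun _ _ h => ⟨h.1.symm, h.2.symm⟩) (fun _ h => h.2 rfl)

theorem exists_finset_injOn_image_eq {α γ : Type*} [DecidableEq α] [DecidableEq γ] [Fintype α]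
    (f : α → γ) : ∃ T : Finset α, Set.InjOn f T ∧ T.card = (Finset.univ.image f).card := by
  have h : ∀ l : Finset.univ.image f, ∃ k, f k = l := fun l => by
    obtain ⟨k, -, hk⟩ := Finset.mem_image.1 l.2
    exact ⟨k, hk⟩
  choose g hg using h
  have hinj : Function.Injective g := fun x y hxy => Subtype.ext (by rw [← hg x, ← hg y, hxy])
  refine ⟨Finset.univ.image g, ?_, ?_⟩
  · intro x hx y hy hxy
    simp only [Finset.coe_image, Finset.coe_univ, Set.image_univ, Set.mem_range] at hx hy
    obtain ⟨u, rfl⟩ := hx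
    obtain ⟨v, rfl⟩ := hy
    rw [hg, hg] at hxy
    rw [Subtype.ext hxy]
  · rw [Finset.card_image_of_injective _ hinj, Finset.card_univ, Fintype.card_coe]

/-- Two balanced labelings with few separated pairs agree up to few errors. -/
theorem mul_errs_le_card_splitPairs {n K : ℕ} {β : ℝ} (hK : 0 < K) (hβ : 0 < β)
    {σ τ : Fin n → Fin K} (hσ : σ ∈ balanced n K β) (hτ : τ ∈ balanced n K β) :
    (n : ℝ) / (β * K) * errs σ τ ≤ 2 * (1 + β ^ 2) * (splitPairs σ τ).card := by
  have : Nonempty (Fin K) := ⟨⟨0, hK⟩⟩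
  have hK' : (0 : ℝ) < K := by exact_mod_cast hK
  set c := (n : ℝ) / (β * K) with hc
  have hc0 : 0 ≤ c := by positivity
  have hup : β * n / K = β ^ 2 * c := by
    rw [hc]
    field_simp
  -- `f k` is a most frequent `τ`-label in the `σ`-class `k`, so `D` counts the vertices outside the
  -- majority of their class.
  have hmax : ∀ k : Fin K, ∃ l : Fin K, ∀ l',
      (Finset.univ.filter (fun j => k = σ j ∧ l ≠ τ j)).card ≤
      (Finset.univ.filter (fun j => k = σ j ∧ l' ≠ τ j)).card := fun k =>
    Finite.exists_min _
  choose f hf using hmax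
  set D := hammingDist (fun i => f (σ i)) τ with hD
  -- Each vertex is separated from at least as many members of its `σ`-class as that class has
  -- minority vertices; class sizes are at least `c`.
  have hsplit : c * D ≤ 2 * (splitPairs σ τ).card := by
    have h1 : (∑ i, (Finset.univ.filter (fun j => σ i = σ j ∧ f (σ j) ≠ τ j)).card) ≤
        2 * (splitPairs σ τ).card := by
      rw [two_mul_card_splitPairs]
      refine Finset.sum_le_sum fun i _ => le_trans (le_of_eq ?_) (hf (σ i) (τ i))
      congr 1
      ext j
      simp only [Finset.mem_filter, Finset.mem_univ, true_and]
      constructor <;> rintro ⟨h, h'⟩ <;> refine ⟨h, ?_⟩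
      · rwa [h]
      · rwa [← h]
    have h2 : (∑ i, (Finset.univ.filter (fun j => σ i = σ j ∧ f (σ j) ≠ τ j)).card) =
        ∑ j ∈ Finset.univ.filter (fun j => f (σ j) ≠ τ j),
          (Finset.univ.filter (fun i => σ i = σ j)).card := by
      simp only [Finset.card_filter]
      rw [Finset.sum_comm, Finset.sum_filter]
      refine Finset.sum_congr rfl fun j _ => ?_
      by_cases h : f (σ j) ≠ τ j <;> simp [h]
    have h3 : c * D ≤ ((∑ j ∈ Finset.univ.filter (fun j => f (σ j) ≠ τ j),
        (Finset.univ.filter (fun i => σ i = σ j)).card : ℕ) : ℝ) := by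
      push_cast
      calc c * D = ∑ _j ∈ Finset.univ.filter (fun j => f (σ j) ≠ τ j), c := by
            rw [Finset.sum_const, nsmul_eq_mul, mul_comm]
            rfl
        _ ≤ _ := Finset.sum_le_sum fun j _ => (hσ (σ j)).1
    rw [← h2] at h3
    exact h3.trans (by exact_mod_cast h1)
  set Mis := (Finset.univ.image f)ᶜ with hMis
  -- All vertices carrying a label that is nobody's majority are minority vertices, and each such
  -- label has at least `c` of them.
  have hmis : Mis.card * c ≤ D := by
    have h1 : (Finset.univ.filter (fun i => τ i ∈ Mis)).card ≤ D := by
      refine Finset.card_le_card fun i hi => ?_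
      simp only [Finset.mem_filter, Finset.mem_univ, true_and, hMis, Finset.mem_compl,
        Finset.mem_image, not_exists] at hi ⊢
      exact hi _
    rw [← Finset.sum_card_fiberwise_eq_card_filter] at h1
    calc Mis.card * c = ∑ _l ∈ Mis, c := by rw [Finset.sum_const, nsmul_eq_mul]
      _ ≤ ∑ l ∈ Mis, ((Finset.univ.filter (fun i => τ i = l)).card : ℝ) :=
          Finset.sum_le_sum fun l _ => (hτ l).1
      _ ≤ D := by exact_mod_cast h1
  -- `f` need not be injective. Restricted to a transversal `T` it extends to a permutation; the
  -- classes outside `T` are as many as the missed labels, and all their vertices are counted as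
  -- errors.
  obtain ⟨T, hTinj, hTcard⟩ := exists_finset_injOn_image_eq f
  obtain ⟨g, hg⟩ := Finset.exists_equiv_extend_of_card_eq (t := (Finset.univ : Finset (Fin K)))
    (by simp) (Finset.subset_univ (T.image f)) hTinj
  set π : Equiv.Perm (Fin K) := g.trans (Equiv.subtypeUnivEquiv fun x => Finset.mem_univ x)
  have hπ : ∀ k ∈ T, π k = f k := hg
  have herr : errs σ τ ≤ D + ∑ k ∈ Tᶜ, (Finset.univ.filter (fun i => σ i = k)).card := by
    rw [errs_comm, Finset.sum_card_fiberwise_eq_card_filter]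
    refine (errs_le τ σ π).trans ((Finset.card_le_card ?_).trans (Finset.card_union_le _ _))
    intro i hi
    simp only [Finset.mem_filter, Finset.mem_univ, true_and, Finset.mem_union,
      Finset.mem_compl] at hi ⊢
    by_cases h : σ i ∈ T
    · rw [hπ _ h] at hi
      exact Or.inl hi.symm
    · exact Or.inr h
  have hTM : (Tᶜ).card = Mis.card := by
    rw [hMis, Finset.card_compl, Finset.card_compl, hTcard]
  have herr' : (errs σ τ : ℝ) ≤ D + β ^ 2 * D := by
    calc (errs σ τ : ℝ) ≤ D + ∑ k ∈ Tᶜ, ((Finset.univ.filter (fun i => σ i = k)).card : ℝ) := by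
          exact_mod_cast herr
      _ ≤ D + ∑ _k ∈ Tᶜ, β ^ 2 * c := by
          gcongr with k _
          exact hup ▸ (hσ k).2
      _ = D + β ^ 2 * (Mis.card * c) := by
          rw [Finset.sum_const, nsmul_eq_mul, hTM]
          ring
      _ ≤ _ := by gcongr
  calc c * errs σ τ ≤ c * (D + β ^ 2 * D) := by gcongr
    _ = (1 + β ^ 2) * (c * D) := by ring
    _ ≤ (1 + β ^ 2) * (2 * (splitPairs σ τ).card) := by gcongr
    _ = _ := by ring

theorem sortedPair_eq_iff {n : ℕ} {i j k l : Fin n} :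
    sortedPair i j = sortedPair k l ↔ (i = k ∧ j = l) ∨ (i = l ∧ j = k) := by
  simp only [sortedPair, Prod.mk.injEq]
  grind

theorem surjective_of_mem_balanced {n K : ℕ} {β : ℝ} (hn : 0 < n) (hK : 0 < K) (hβ : 0 < β)
    {σ : Fin n → Fin K} (hσ : σ ∈ balanced n K β) : Function.Surjective σ := by
  intro k
  have h1 : (0 : ℝ) < (n : ℝ) / (β * K) := by positivity
  have h2 := h1.trans_le (hσ k).1
  have h3 : 0 < (Finset.univ.filter (fun i => σ i = k)).card := by exact_mod_cast h2
  obtain ⟨i, hi⟩ := Finset.card_pos.1 h3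
  exact ⟨i, (Finset.mem_filter.1 hi).2⟩

/-- Inequivalent balanced labelings separate at least as many pairs as moving one vertex does. -/
theorem sub_one_le_card_splitPairs {n K : ℕ} {β : ℝ} (hn : 0 < n) (hK : 0 < K) (hβ : 0 < β)
    {σ τ : Fin n → Fin K} (hσ : σ ∈ balanced n K β) (hτ : τ ∈ balanced n K β)
    (h : 0 < errs σ τ) : (n : ℝ) / (β * K) - 1 ≤ (splitPairs σ τ).card := by
  -- Otherwise `τ` factors through `σ` by a surjection of `Fin K`, which is a permutation, and there
  -- are no errors.
  have hsplit : ∃ i j, σ i = σ j ∧ τ i ≠ τ j := by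
    by_contra! hc
    obtain ⟨s, hs⟩ := (surjective_of_mem_balanced hn hK hβ hσ).hasRightInverse
    have hfac : ∀ i, τ (s (σ i)) = τ i := fun i => hc _ _ (hs (σ i))
    have hsurj : Function.Surjective (fun k => τ (s k)) := fun l => by
      obtain ⟨i, hi⟩ := surjective_of_mem_balanced hn hK hβ hτ l
      exact ⟨σ i, (hfac i).trans hi⟩
    have hle := errs_le τ σ (Equiv.ofBijective _ (Finite.surjective_iff_bijective.1 hsurj))
    simp only [Equiv.ofBijective_apply, hfac] at hle
    rw [hammingDist_self, ← errs_comm] at hle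
    omega
  obtain ⟨i, j, hij, hτij⟩ := hsplit
  -- Every `u` in the class of `i` is separated from `i` or from `j`. The vertex `i` is left out
  -- because it would yield the same pair as `j`; this is the loss of 1.
  have hcard : ((Finset.univ.filter (fun u => σ u = σ i)).erase i).card ≤
      (splitPairs σ τ).card := by
    refine Finset.card_le_card_of_injOn
      (fun u => if τ u = τ i then sortedPair j u else sortedPair i u) ?_ ?_
    · intro u hu
      simp only [Finset.coe_erase, Finset.coe_filter, Finset.mem_univ, true_and,
        Set.mem_sdiff, Set.mem_ofPred_eq, Set.mem_singleton_iff] at hu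
      have hmem : ∀ v, σ v = σ u → τ v ≠ τ u → sortedPair v u ∈ splitPairs σ τ := by
        intro v h1 h2
        have hne : v ≠ u := fun h => h2 (by rw [h])
        simp only [splitPairs, Finset.mem_filter, mem_pairs, sortedPair]
        rcases lt_or_gt_of_ne hne with h' | h'
        · simp [h'.le, h', h1, h2]
        · simp [h'.le, h', h1, h2.symm]
      by_cases hui : τ u = τ i
      · simp only [hui, if_true]
        refine hmem j (hij.symm.trans hu.1.symm) ?_
        rw [hui]
        exact hτij.symm
      · simp only [hui, if_false]
        exact hmem i hu.1.symm (fun h => hui h.symm)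
    · intro u hu v hv huv
      simp only [Finset.coe_erase, Finset.coe_filter, Finset.mem_univ, true_and,
        Set.mem_sdiff, Set.mem_ofPred_eq, Set.mem_singleton_iff] at hu hv
      have hne : i ≠ j := fun h => hτij (by rw [h])
      simp only at huv
      split_ifs at huv <;> rw [sortedPair_eq_iff] at huv <;> grind
  rw [Finset.card_erase_of_mem (by simp)] at hcard
  have h1 : (Finset.univ.filter (fun u => σ u = σ i)).card ≤ (splitPairs σ τ).card + 1 := by
    omega
  have h2 : ((Finset.univ.filter (fun u => σ u = σ i)).card : ℝ) ≤ (splitPairs σ τ).card + 1 := by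
    exact_mod_cast h1
  linarith [(hσ (σ i)).1]

/-- For two classes, the separated pairs join an error to a correct vertex. -/
theorem card_splitPairs_add_of_two {n : ℕ} (σ τ : Fin n → Fin 2) :
    (splitPairs σ τ).card + (splitPairs τ σ).card =
      hammingDist σ τ * (n - hammingDist σ τ) := by
  -- With two labels, a pair changes status exactly when one of its ends is an error and the other
  -- is not.
  have hP : (splitPairs σ τ).card + (splitPairs τ σ).card =
      ((pairs n).filter (fun e => ¬(σ e.1 ≠ τ e.1 ↔ σ e.2 ≠ τ e.2))).card := by
    rw [← Finset.card_union_of_disjoint]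
    · congr 1
      ext e
      simp only [splitPairs, Finset.mem_union, Finset.mem_filter]
      generalize σ e.1 = p, σ e.2 = q, τ e.1 = r, τ e.2 = s
      rw [← and_or_left]
      refine and_congr_right fun _ => ?_
      revert p q r s
      decide
    · rw [Finset.disjoint_left]
      intro e h1 h2
      simp only [splitPairs, Finset.mem_filter] at h1 h2
      exact h1.2.2 h2.2.1
  have h2 := two_mul_card_filter_pairs
    (fun i j => ¬(σ i ≠ τ i ↔ σ j ≠ τ j)) (fun i j h => fun h' => h h'.symm) (fun i h => h Iff.rfl)
  have hnot : (Finset.univ.filter (fun j => ¬ σ j ≠ τ j)).card = n - hammingDist σ τ := by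
    have := Finset.card_filter_add_card_filter_not (s := Finset.univ) (fun j => σ j ≠ τ j)
    rw [Finset.card_univ, Fintype.card_fin] at this
    unfold hammingDist
    omega
  have hrow : ∀ i, (Finset.univ.filter (fun j => ¬(σ i ≠ τ i ↔ σ j ≠ τ j))).card =
      if σ i ≠ τ i then n - hammingDist σ τ else hammingDist σ τ := by
    intro i
    split_ifs with h
    · rw [← hnot]
      congr 1
      ext j
      simp [h]
    · unfold hammingDist
      congr 1
      ext j
      simp [h]
  simp only [hrow] at h2
  rw [Finset.sum_ite, Finset.sum_const, Finset.sum_const, hnot, smul_eq_mul, smul_eq_mul] at h2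
  change _ = hammingDist σ τ * _ + _ at h2
  rw [hP]
  linarith

/-- Swapping the two names exchanges errors and correct vertices. -/
theorem errs_le_sub_of_two {n : ℕ} (σ τ : Fin n → Fin 2) :
    errs σ τ ≤ n - hammingDist σ τ := by
  refine (errs_le σ τ (Equiv.swap 0 1)).trans (le_of_eq ?_)
  have h := Finset.card_filter_add_card_filter_not (s := Finset.univ) (fun j => σ j ≠ τ j)
  rw [Finset.card_univ, Fintype.card_fin] at h
  have : hammingDist σ (fun i => Equiv.swap 0 1 (τ i)) =
      (Finset.univ.filter (fun j => ¬ σ j ≠ τ j)).card := by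
    unfold hammingDist
    congr 1
    ext i
    simp only [Finset.mem_filter, Finset.mem_univ, true_and]
    generalize σ i = p, τ i = q
    revert p q
    decide
  rw [this]
  unfold hammingDist
  omega

/-- The number of pairs behind the signal. -/
noncomputable def signalPairs (n K : ℕ) (β : ℝ) : ℝ := if K = 2 then n / 2 else n / (β * K)

theorem signal_eq (n K : ℕ) (β a b : ℝ) :
    signal n K β a b = signalPairs n K β * renyiI n a b := by
  unfold signal signalPairs
  split_ifs <;> ring

/-- The first bound keeps the sharp constant for few errors; the second grows with the errors and
beats the entropy. For `K = 2` the cost is `d(n - d)/2`. For `K ≥ 3` it is a convex combination of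
two split counts, each obeying both bounds, and `3/16 = 1/(2(1 + 5/3))` comes from `β² ≤ 5/3`. -/
theorem pairCost_lower_bounds {n K : ℕ} {β w : ℝ} (hn : 2 ≤ n) (hK : 2 ≤ K) (hβ : 1 ≤ β)
    (hβ' : 3 ≤ K → β < √(5 / 3)) (hw0 : 0 ≤ w) (hw1 : w ≤ 1) {σ₀ σ : Fin n → Fin K}
    (h₀ : σ₀ ∈ balanced n K β) (h : σ ∈ balanced n K β) (hpos : 0 < errs σ₀ σ) :
    signalPairs n K β - 1 ≤ pairCost w σ₀ σ ∧
      3 / 16 * signalPairs n K β * errs σ₀ σ ≤ pairCost w σ₀ σ := by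
  rcases eq_or_lt_of_le hK with rfl | hK3
  · have hsum := card_splitPairs_add_of_two σ₀ σ
    have hd1 : errs σ₀ σ ≤ hammingDist σ₀ σ := errs_le σ₀ σ 1
    have hd2 := errs_le_sub_of_two σ₀ σ
    set d := hammingDist σ₀ σ
    obtain ⟨e, he⟩ : ∃ e, n = d + e := ⟨n - d, by omega⟩
    have hsub : n - d = e := by omega
    rw [hsub] at hsum hd2
    have hcost : pairCost w σ₀ σ = (d : ℝ) * e / 2 := by
      have : ((splitPairs σ₀ σ).card : ℝ) + (splitPairs σ σ₀).card = d * e := by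
        exact_mod_cast hsum
      unfold pairCost effWeight
      rw [if_pos rfl]
      linarith
    have hnr : (n : ℝ) = d + e := by exact_mod_cast he
    have h1 : (1 : ℝ) ≤ errs σ₀ σ := by exact_mod_cast hpos
    have h2 : (errs σ₀ σ : ℝ) ≤ d := by exact_mod_cast hd1
    have h3 : (errs σ₀ σ : ℝ) ≤ e := by exact_mod_cast hd2
    rw [hcost]
    unfold signalPairs
    rw [if_pos rfl, hnr]
    constructor
    · nlinarith
    · have e1 : (errs σ₀ σ : ℝ) * d ≤ e * d := by gcongr
      have e2 : (errs σ₀ σ : ℝ) * e ≤ d * e := by gcongr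
      have e3 : (0 : ℝ) ≤ d * e := by positivity
      nlinarith
  · have hβ0 : 0 < β := by linarith
    have hβ2 : β ^ 2 ≤ 5 / 3 := by
      have := hβ' hK3
      calc β ^ 2 ≤ √(5 / 3) ^ 2 := by gcongr
        _ = 5 / 3 := Real.sq_sqrt (by norm_num)
    have hK0 : 0 < K := by omega
    have hn0 : 0 < n := by omega
    obtain ⟨hW0, hW1⟩ := effWeight_mem (K := K) hw0 hw1
    have hSP : signalPairs n K β = n / (β * K) := if_neg (by omega)
    rw [hSP]
    have hkey : ∀ {σ τ : Fin n → Fin K}, σ ∈ balanced n K β → τ ∈ balanced n K β →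
        0 < errs σ τ → (n : ℝ) / (β * K) - 1 ≤ (splitPairs σ τ).card ∧
        3 / 16 * (n / (β * K)) * errs σ τ ≤ (splitPairs σ τ).card := by
      intro σ τ hσ hτ hp
      refine ⟨sub_one_le_card_splitPairs hn0 hK0 hβ0 hσ hτ hp, ?_⟩
      have h1 := mul_errs_le_card_splitPairs hK0 hβ0 hσ hτ
      have h2 : 2 * (1 + β ^ 2) * ((splitPairs σ τ).card : ℝ) ≤
          16 / 3 * (splitPairs σ τ).card := by
        gcongr
        linarith
      linarith
    obtain ⟨a1, a2⟩ := hkey h₀ h hpos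
    obtain ⟨b1, b2⟩ := hkey h h₀ (by rwa [errs_comm])
    rw [errs_comm σ σ₀] at b2
    unfold pairCost
    constructor <;> nlinarith

/-! ### Counting labelings by their number of errors -/

/-- The sum factorizes over vertices, each factor being at most `1 + Kz`. -/
theorem sum_pow_hammingDist_le {n K : ℕ} (σ₀ : Fin n → Fin K) {z : ℝ} (hz : 0 ≤ z) :
    ∑ σ : Fin n → Fin K, z ^ hammingDist σ₀ σ ≤ Real.exp (n * (K * z)) := by
  have h1 : ∀ σ : Fin n → Fin K, z ^ hammingDist σ₀ σ = ∏ i, (if σ₀ i ≠ σ i then z else 1) := by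
    intro σ
    rw [← Finset.prod_filter, Finset.prod_const]
    rfl
  simp only [h1]
  rw [← Fintype.prod_sum (fun i k => if σ₀ i ≠ k then z else 1)]
  calc (∏ i, ∑ k, if σ₀ i ≠ k then z else 1) ≤ ∏ _i : Fin n, Real.exp (K * z) := by
        refine Finset.prod_le_prod (fun i _ => Finset.sum_nonneg fun k _ => ?_) fun i _ => ?_
        · split_ifs <;> positivity
        · calc (∑ k, if σ₀ i ≠ k then z else 1) ≤ ∑ k, (z + if σ₀ i = k then 1 else 0) := by
                refine Finset.sum_le_sum fun k _ => ?_
                by_cases h : σ₀ i = k <;> simp [h, hz]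
            _ = K * z + 1 := by
                rw [Finset.sum_add_distrib]
                simp
            _ ≤ _ := Real.add_one_le_exp _
    _ = _ := by
        rw [Finset.prod_const, Finset.card_univ, Fintype.card_fin, ← Real.exp_nat_mul]

/-- The optimal relabeling is replaced by a sum over all `K!` of them, each a bijection on
labelings. -/
theorem sum_pow_errs_le {n K : ℕ} (σ₀ : Fin n → Fin K) {z : ℝ} (hz : 0 ≤ z) :
    ∑ σ : Fin n → Fin K, z ^ errs σ₀ σ ≤ K.factorial * Real.exp (n * (K * z)) := by
  calc ∑ σ : Fin n → Fin K, z ^ errs σ₀ σ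
      ≤ ∑ σ : Fin n → Fin K, ∑ π : Equiv.Perm (Fin K),
          z ^ hammingDist σ₀ (fun i => π (σ i)) := by
        refine Finset.sum_le_sum fun σ _ => ?_
        obtain ⟨π, hπ⟩ := exists_errs_eq σ₀ σ
        rw [hπ]
        exact Finset.single_le_sum
          (f := fun π : Equiv.Perm (Fin K) => z ^ hammingDist σ₀ (fun i => π (σ i)))
          (fun _ _ => by positivity) (Finset.mem_univ π)
    _ = ∑ π : Equiv.Perm (Fin K), ∑ σ : Fin n → Fin K, z ^ hammingDist σ₀ σ := by
        rw [Finset.sum_comm]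
        refine Finset.sum_congr rfl fun π _ => ?_
        exact Equiv.sum_comp (Equiv.piCongrRight fun _ : Fin n => π)
          (fun σ => z ^ hammingDist σ₀ σ)
    _ ≤ ∑ _π : Equiv.Perm (Fin K), Real.exp (n * (K * z)) :=
        Finset.sum_le_sum fun _ _ => sum_pow_hammingDist_le σ₀ hz
    _ = _ := by
        rw [Finset.sum_const, Finset.card_univ, Fintype.card_perm, Fintype.card_fin, nsmul_eq_mul]

theorem one_le_log_mul {n K : ℕ} (hn : 2 ≤ n) (hK : 2 ≤ K) : 1 ≤ Real.log (n * K) := by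
  have h1 : (4 : ℝ) ≤ n * K := by
    have : 2 * 2 ≤ n * K := Nat.mul_le_mul hn hK
    exact_mod_cast this
  have h2 : Real.exp 1 ≤ n * K := by linarith [Real.exp_one_lt_d9]
  rwa [Real.le_log_iff_exp_le (by linarith)]

/-- Under mild growth of `K`, the number of labelings is controlled by `nK` per error. -/
theorem sum_exp_errs_le {n K : ℕ} {Cmg : ℝ} (hn : 2 ≤ n) (hK : 2 ≤ K) (hCmg : 0 < Cmg)
    (hg : Cmg * (K * Real.log K) ≤ Real.log (n * K)) (σ₀ : Fin n → Fin K) :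
    ∑ σ : Fin n → Fin K, Real.exp (-(2 * Real.log (n * K) * errs σ₀ σ)) ≤
      Real.exp ((1 + 1 / Cmg) * Real.log (n * K)) := by
  have hL := one_le_log_mul hn hK
  have hK0 : (0 : ℝ) < K := by positivity
  have hn0 : (0 : ℝ) < n := by positivity
  set L := Real.log (n * K) with hLdef
  have hexpL : Real.exp L = n * K := Real.exp_log (by positivity)
  have h1 : ∀ σ : Fin n → Fin K, Real.exp (-(2 * L * errs σ₀ σ)) =
      Real.exp (-(2 * L)) ^ errs σ₀ σ := by
    intro σ
    rw [← Real.exp_nat_mul]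
    congr 1
    ring
  simp only [h1]
  refine (sum_pow_errs_le σ₀ (Real.exp_pos _).le).trans ?_
  -- Here `z = (nK)^{-2}`, so the exponent is `1/(nK) ≤ 1 ≤ L`.
  have h2 : (n : ℝ) * (K * Real.exp (-(2 * L))) ≤ L := by
    rw [← mul_assoc, ← hexpL, ← Real.exp_add]
    exact (Real.exp_le_one_iff.2 (by linarith)).trans hL
  have h3 : (K.factorial : ℝ) ≤ Real.exp (1 / Cmg * L) := by
    calc (K.factorial : ℝ) ≤ (K : ℝ) ^ K := by exact_mod_cast Nat.factorial_le_pow K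
      _ = Real.exp (K * Real.log K) := by
          rw [Real.exp_nat_mul, Real.exp_log hK0]
      _ ≤ _ := by
          refine Real.exp_le_exp.2 ?_
          rw [one_div, inv_mul_eq_div, le_div_iff₀ hCmg]
          linarith
  calc K.factorial * Real.exp (n * (K * Real.exp (-(2 * L))))
      ≤ Real.exp (1 / Cmg * L) * Real.exp L := by gcongr
    _ = _ := by
        rw [← Real.exp_add]
        congr 1
        ring

/-! ### The risk of the private estimator -/

theorem sum_toReal_pmf {Y : Type*} [Fintype Y] (p : PMF Y) : ∑ y, (p y).toReal = 1 := by
  rw [← ENNReal.toReal_sum fun y _ => p.apply_ne_top y, ← tsum_fintype (L := .unconditional _),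
    p.tsum_coe, ENNReal.toReal_one]

theorem sum_pmf_mul_mismatch_le_one {n K : ℕ} (σ₀ : Fin n → Fin K) (p : PMF (Fin n → Fin K)) :
    ∑ σ, (p σ).toReal * mismatch σ₀ σ ≤ 1 := by
  rw [← sum_toReal_pmf p]
  exact Finset.sum_le_sum fun σ _ =>
    mul_le_of_le_one_right ENNReal.toReal_nonneg (mismatch_le_one σ₀ σ)

theorem expectedMismatch_le_one {n K : ℕ} {a b : ℝ} (hb : 0 ≤ b) (hab : b ≤ a) (han : a ≤ n)
    (σ₀ : Fin n → Fin K) (M : SimpleGraph (Fin n) → PMF (Fin n → Fin K)) :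
    expectedMismatch a b σ₀ M ≤ 1 := by
  classical
  rw [← sum_sbmProb a b σ₀]
  exact Finset.sum_le_sum fun A _ => mul_le_of_le_one_right (sbmProb_nonneg hb hab han σ₀ A)
    (sum_pmf_mul_mismatch_le_one σ₀ (M A))

/-- The exponential mechanism is bounded by exponential moments of smaller tilt. -/
theorem emProb_le_exp {n K : ℕ} {β a b w C ε θ : ℝ} {σ₀ : Fin n → Fin K}
    (h₀ : σ₀ ∈ balanced n K β) (hθ0 : 0 ≤ θ) (hθ : θ ≤ eta n C a ε) (A : SimpleGraph (Fin n))
    (σ : Fin n → Fin K) :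
    emProb β a b w C ε A σ ≤ Real.exp (θ *
      (score (penalty n K a b w) A σ - score (penalty n K a b w) A σ₀)) := by
  rw [emProb_eq_gibbs]
  set d := score (penalty n K a b w) A σ - score (penalty n K a b w) A σ₀ with hd
  -- For `d ≥ 0` the trivial bound 1 suffices; for `d ≤ 0` comparison with the truth gives `e^{ηd}`,
  -- and lowering the tilt only increases it.
  rcases le_total 0 d with h | h
  · exact (gibbs_le_one σ).trans (Real.one_le_exp (mul_nonneg hθ0 h))
  · refine (gibbs_le_exp_sub h₀ σ).trans (Real.exp_le_exp.2 ?_)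
    have heta : ε / 2 / (2 * sens n C a) = eta n C a ε := by
      unfold eta
      rw [div_div]
      congr 1
      ring
    rw [← mul_sub, heta, ← hd]
    exact mul_le_mul_of_nonpos_right hθ h

open Classical in
/-- The risk is bounded by the exponential moments of the inequivalent balanced labelings. -/
theorem expectedMismatch_le_sum {n K : ℕ} {β a b w C ε x : ℝ} (hC : 26 ≤ C) (hn : 2 ≤ n)
    (hb : 0 < b) (hab : b < a) (han : a < n) {σ₀ : Fin n → Fin K} (h₀ : σ₀ ∈ balanced n K β)
    {M : SimpleGraph (Fin n) → PMF (Fin n → Fin K)} (hM : IsPrivateEstimator β a b w C ε M)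
    (hx0 : 0 ≤ x) (hx1 : x ≤ 1) (hx : x * tStar n a b ≤ eta n C a ε) :
    expectedMismatch a b σ₀ M ≤
      (∑ σ ∈ Finset.univ.filter (fun σ => σ ∈ balanced n K β ∧ 0 < errs σ₀ σ),
        Real.exp (-(x * (renyiI n a b * pairCost w σ₀ σ)))) +
      Real.exp (-10 * (a + Real.log n)) := by
  have ht := (tStar_pos hb hab han).le
  set G := Finset.univ.filter (fun σ => σ ∈ balanced n K β ∧ 0 < errs σ₀ σ) with hG
  set E : SimpleGraph (Fin n) → (Fin n → Fin K) → ℝ := fun A σ =>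
    Real.exp (x * tStar n a b *
      (score (penalty n K a b w) A σ - score (penalty n K a b w) A σ₀)) with hE
  have hpt : ∀ A : SimpleGraph (Fin n), ∑ σ, (M A σ).toReal * mismatch σ₀ σ ≤
      (∑ σ ∈ G, E A σ) + if A ∉ envelope n C a then 1 else 0 := by
    intro A
    have hE0 : 0 ≤ ∑ σ ∈ G, E A σ := Finset.sum_nonneg fun _ _ => (Real.exp_pos _).le
    by_cases hA : A ∈ envelope n C a
    · rw [if_neg (not_not.2 hA), add_zero, hG, Finset.sum_filter]
      refine Finset.sum_le_sum fun σ _ => ?_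
      by_cases hσ : σ ∈ balanced n K β
      · rcases Nat.eq_zero_or_pos (errs σ₀ σ) with h | h
        · simp [mismatch_eq_errs_div, h]
        · rw [if_pos ⟨hσ, h⟩]
          refine (mul_le_of_le_one_right ENNReal.toReal_nonneg (mismatch_le_one σ₀ σ)).trans ?_
          rw [hM.eq_em A hA σ, ENNReal.toReal_ofReal (by
            rw [emProb_eq_gibbs]
            exact gibbs_nonneg σ)]
          exact emProb_le_exp h₀ (mul_nonneg hx0 ht) hx A σ
      · have : M A σ = 0 := by
          by_contra h
          exact hσ (hM.mem_balanced A ((PMF.mem_support_iff _ _).2 h))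
        simp [this, hσ]
    · rw [if_pos hA]
      linarith [sum_pmf_mul_mismatch_le_one σ₀ (M A)]
  have hout := le_sbmMeasure_envelope hC hn hb.le hab.le han.le σ₀
  calc expectedMismatch a b σ₀ M
      ≤ ∑ A : SimpleGraph (Fin n), sbmProb a b σ₀ A *
          ((∑ σ ∈ G, E A σ) + if A ∉ envelope n C a then 1 else 0) :=
        Finset.sum_le_sum fun A _ => mul_le_mul_of_nonneg_left (hpt A)
          (sbmProb_nonneg hb.le hab.le han.le σ₀ A)
    _ = (∑ σ ∈ G, ∑ A : SimpleGraph (Fin n), sbmProb a b σ₀ A * E A σ) +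
          (1 - sbmMeasure a b σ₀ (envelope n C a)) := by
        rw [← sum_not_mem_sbmProb, Finset.sum_filter (fun A => A ∉ envelope n C a),
          Finset.sum_comm, ← Finset.sum_add_distrib]
        refine Finset.sum_congr rfl fun A _ => ?_
        rw [mul_add, Finset.mul_sum, mul_ite, mul_one, mul_zero]
    _ ≤ _ := by
        refine add_le_add (Finset.sum_le_sum fun σ _ => ?_) (by linarith)
        exact sum_sbmProb_exp_mul_tStar_le hb hab han w σ₀ σ hx0 hx1

/-- The affinity is at least `√ρ p + (1 - p) ≥ √ρ`, where `ρ` is `rlo`. Bounded `I` makes the pair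
lost in `signalPairs - 1` harmless. -/
theorem renyiI_le {n : ℕ} {a b rlo : ℝ} (hlo : 0 < rlo) (hb : 0 < b) (hab : b < a) (han : a < n)
    (hr : rlo ≤ b / a) : renyiI n a b ≤ -Real.log rlo := by
  have hn : 0 < (n : ℝ) := by linarith
  have ha : 0 < a := hb.trans hab
  have hp : a / n < 1 := (div_lt_one hn).2 han
  have hqp : b / n < a / n := by gcongr
  have hp0 : 0 < a / n := by positivity
  have hr1 : rlo ≤ 1 := hr.trans ((div_le_one ha).2 hab.le)
  have hrq : rlo * (a / n) ≤ b / n := by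
    rw [le_div_iff₀ ha] at hr
    rw [← mul_div_assoc]
    gcongr
  unfold renyiI
  set p := a / n
  set q := b / n
  have h1 : √rlo * p ≤ √(p * q) := by
    refine Real.le_sqrt_of_sq_le ?_
    rw [mul_pow, Real.sq_sqrt hlo.le]
    nlinarith
  have h2 : 1 - p ≤ √((1 - p) * (1 - q)) := by
    refine Real.le_sqrt_of_sq_le ?_
    nlinarith
  have h3 : √rlo ≤ 1 := Real.sqrt_le_one.2 hr1
  have h4 : √rlo ≤ √(p * q) + √((1 - p) * (1 - q)) := by nlinarith
  have h5 := Real.log_le_log (Real.sqrt_pos.2 hlo) h4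
  rw [Real.log_sqrt hlo.le] at h5
  linarith

/-! ### Risk bounds under the standing assumptions -/

section Regime

variable {rlo rhi Cs Cmg : ℝ} {n K : ℕ} {β a b : ℝ}

theorem Regime.a_pos (h : Regime rlo rhi Cs Cmg n K β a b) : 0 < a :=
  h.b_nonneg.trans_lt h.b_lt_a

theorem Regime.b_pos (h : Regime rlo rhi Cs Cmg n K β a b) (hlo : 0 < rlo) : 0 < b := by
  have h1 := hlo.trans_le h.le_ratio
  rcases h.b_nonneg.eq_or_lt with h2 | h2
  · rw [← h2, zero_div] at h1
    exact absurd h1 (lt_irrefl 0)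
  · exact h2

theorem Regime.one_le_log (h : Regime rlo rhi Cs Cmg n K β a b) : 1 ≤ Real.log (n * K) :=
  one_le_log_mul h.two_le_n h.two_le_K

theorem Regime.signalPairs_pos (h : Regime rlo rhi Cs Cmg n K β a b) :
    0 < signalPairs n K β := by
  have hn : (0 : ℝ) < n := by exact_mod_cast (by linarith [h.two_le_n] : 0 < n)
  have hK : (0 : ℝ) < K := by exact_mod_cast (by linarith [h.two_le_K] : 0 < K)
  have hβ : 0 < β := by linarith [h.one_le_β]
  unfold signalPairs
  split_ifs <;> positivity

theorem Regime.renyiI_pos (h : Regime rlo rhi Cs Cmg n K β a b) (hCs : 0 < Cs) :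
    0 < renyiI n a b := by
  have h1 : 0 < signal n K β a b :=
    (mul_pos hCs (by linarith [h.one_le_log])).trans_le h.signal_entropy
  rw [signal_eq] at h1
  exact pos_of_mul_pos_right h1 h.signalPairs_pos.le

theorem Regime.bias_pos (h : Regime rlo rhi Cs Cmg n K β a b) (hCs : 0 < Cs) {C₀ : ℝ}
    (hC₀ : 0 < C₀) : 0 < bias n K C₀ a b := by
  have hn : (0 : ℝ) < n := by exact_mod_cast (by linarith [h.two_le_n] : 0 < n)
  have hK : (0 : ℝ) < K := by exact_mod_cast (by linarith [h.two_le_K] : 0 < K)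
  have hI := h.renyiI_pos hCs
  have hL : 0 < Real.log (n * K) := by linarith [h.one_le_log]
  unfold bias
  positivity

theorem Regime.sens_pos (h : Regime rlo rhi Cs Cmg n K β a b) {C : ℝ} (hC : 0 < C) :
    0 < sens n C a := by
  have := h.a_pos.trans_le (le_max_left a (Real.log n))
  unfold sens
  positivity

/-- The exponent rate in the risk bound. -/
noncomputable def riskRate (Cmg rlo : ℝ) : ℝ := 21 + 1 / Cmg - Real.log rlo

/-- Risk bound at the tilt `x t⋆`. -/
theorem Regime.expectedMismatch_le (h : Regime rlo rhi Cs Cmg n K β a b) (hCs : 0 < Cs)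
    (hCmg : 0 < Cmg) (hlo : 0 < rlo) {w C ε x : ℝ} (hw0 : 0 ≤ w) (hw1 : w ≤ 1) (hC : 26 ≤ C)
    {σ₀ : Fin n → Fin K} (h₀ : σ₀ ∈ balanced n K β)
    {M : SimpleGraph (Fin n) → PMF (Fin n → Fin K)} (hM : IsPrivateEstimator β a b w C ε M)
    (hx0 : 0 ≤ x) (hx1 : x ≤ 1) (hx : x * tStar n a b ≤ eta n C a ε)
    (hS : 24 * Real.log (n * K) ≤ x * signal n K β a b) :
    expectedMismatch a b σ₀ M ≤
      Real.exp (riskRate Cmg rlo * Real.log (n * K) - x * signal n K β a b) +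
      Real.exp (-10 * (a + Real.log n)) := by
  classical
  have hb := h.b_pos hlo
  have hL := h.one_le_log
  have hI := h.renyiI_pos hCs
  have hIle := renyiI_le hlo hb h.b_lt_a h.a_lt_n h.le_ratio
  refine (expectedMismatch_le_sum hC h.two_le_n hb h.b_lt_a h.a_lt_n h₀ hM hx0 hx1 hx).trans ?_
  gcongr ?_ + _
  have hsig := signal_eq n K β a b
  set L := Real.log (n * K)
  set S := signal n K β a b
  set I := renyiI n a b
  set κ := -Real.log rlo with hκ
  have hxI : x * I ≤ κ * L := by
    have h1 : x * I ≤ I := mul_le_of_le_one_left hI.le hx1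
    have h2 : κ ≤ κ * L := le_mul_of_one_le_right (by linarith) hL
    linarith
  have hterm : ∀ σ ∈ Finset.univ.filter (fun σ => σ ∈ balanced n K β ∧ 0 < errs σ₀ σ),
      Real.exp (-(x * (I * pairCost w σ₀ σ))) ≤
      Real.exp ((20 + κ) * L - x * S) * Real.exp (-(2 * L * errs σ₀ σ)) := by
    intro σ hσ
    simp only [Finset.mem_filter, Finset.mem_univ, true_and] at hσ
    obtain ⟨h1, h2⟩ := pairCost_lower_bounds h.two_le_n h.two_le_K h.one_le_β h.β_lt hw0 hw1
      h₀ hσ.1 hσ.2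
    have hxI0 : 0 ≤ x * I := mul_nonneg hx0 hI.le
    have h1' := mul_le_mul_of_nonneg_left h1 hxI0
    have h2' := mul_le_mul_of_nonneg_left h2 hxI0
    have e1 : x * I * (signalPairs n K β - 1) = x * S - x * I := by
      rw [hsig]
      ring
    have e2 : x * I * (3 / 16 * signalPairs n K β * errs σ₀ σ) =
        3 / 16 * errs σ₀ σ * (x * S) := by
      rw [hsig]
      ring
    rw [e1] at h1'
    rw [e2] at h2'
    rw [← Real.exp_add]
    refine Real.exp_le_exp.2 ?_
    rw [← mul_assoc]
    set m := errs σ₀ σ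
    -- For `m ≤ 10` the weight `e^{-2Lm}` is worth at most `20L`, the 20 in the prefactor. For `m ≥
    -- 11`, `3m/16 ≥ 1 + m/12`, and `xS ≥ 24L` turns `m/12` into `2Lm`.
    rcases le_or_gt m 10 with hm | hm
    · have hm' : (m : ℝ) ≤ 10 := by exact_mod_cast hm
      nlinarith
    · have hm' : (11 : ℝ) ≤ m := by exact_mod_cast hm
      have hκL : 0 ≤ κ * L := hxI0.trans hxI
      have h3 : (m : ℝ) / 12 * (24 * L) ≤ m / 12 * (x * S) := by gcongr
      have h4 : (1 + (m : ℝ) / 12) * (x * S) ≤ 3 / 16 * m * (x * S) :=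
        mul_le_mul_of_nonneg_right (by linarith) (by linarith)
      nlinarith
  calc (∑ σ ∈ Finset.univ.filter (fun σ => σ ∈ balanced n K β ∧ 0 < errs σ₀ σ),
        Real.exp (-(x * (I * pairCost w σ₀ σ))))
      ≤ ∑ σ : Fin n → Fin K,
          Real.exp ((20 + κ) * L - x * S) * Real.exp (-(2 * L * errs σ₀ σ)) :=
        (Finset.sum_le_sum hterm).trans (Finset.sum_le_sum_of_subset_of_nonneg
          (Finset.filter_subset _ _) fun _ _ _ => by positivity)
    _ ≤ Real.exp ((20 + κ) * L - x * S) * Real.exp ((1 + 1 / Cmg) * L) := by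
        rw [← Finset.mul_sum]
        gcongr
        exact sum_exp_errs_le h.two_le_n h.two_le_K hCmg h.mild_growth σ₀
    _ = _ := by
        rw [← Real.exp_add]
        congr 1
        unfold riskRate
        ring

/-- The general risk bound. -/
theorem Regime.risk_bound (h : Regime rlo rhi Cs Cmg n K β a b)
    (hCmg : 0 < Cmg) (hlo : 0 < rlo) (hrate : 0 < riskRate Cmg rlo)
    (hCs : Cs = 2 * riskRate Cmg rlo + 24) {w C ε α C₀ : ℝ} (hw0 : 0 ≤ w) (hw1 : w ≤ 1)
    (hC : 26 ≤ C) (hC₀ : 0 < C₀) (hγ : 0 < eta n C a ε - bias n K C₀ a b)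
    {σ₀ : Fin n → Fin K} (h₀ : σ₀ ∈ balanced n K β)
    {M : SimpleGraph (Fin n) → PMF (Fin n → Fin K)} (hM : IsPrivateEstimator β a b w C ε M)
    (hα0 : 0 < α) (hα : α < 1 / 2) :
    expectedMismatch a b σ₀ M ≤
      Real.exp (-signal n K β a b
          + tStar n a b * sStar n K C C₀ (riskRate Cmg rlo + 24) a b ε α)
        + α + Real.exp (-(1 / 2) * signal n K β a b) + Real.exp (-10 * (a + Real.log n)) := by
  have hCs0 : 0 < Cs := by linarith
  have hB := h.bias_pos hCs0 hC₀
  have hb := h.b_pos hlo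
  have ht := tStar_pos hb h.b_lt_a h.a_lt_n
  have hL := h.one_le_log
  have hS := h.signal_entropy
  have hℓ : 0 < Real.log (4 / α) := by
    refine Real.log_pos ?_
    rw [one_lt_div hα0]
    linarith
  have hcore := fun x => h.expectedMismatch_le (x := x) hCs0 hCmg hlo hw0 hw1 hC h₀ hM
  unfold sStar
  set L := Real.log (n * K)
  set S := signal n K β a b
  set Q := riskRate Cmg rlo
  set η := eta n C a ε
  set B := bias n K C₀ a b
  set t := tStar n a b
  set ℓ := Real.log (4 / α) with hℓdef
  have hη : 0 < η := by linarith
  rw [hCs] at hS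
  have hQL : 0 < Q * L := by positivity
  set Z := Real.exp (-S + t * (((Q + 24) * L + ℓ) / (η - B)))
  have hZ : 0 < Z := Real.exp_pos _
  -- If `t⋆ ≤ η` the full tilt is allowed, and `S ≥ (2Q + 24)L` gives `QL - S ≤ -S/2`.
  rcases le_or_gt t η with hcase | hcase
  · have h1 := hcore 1 zero_le_one le_rfl (by linarith) (by linarith)
    have h2 : Real.exp (Q * L - 1 * S) ≤ Real.exp (-(1 / 2) * S) :=
      Real.exp_le_exp.2 (by linarith)
    linarith
  · have hxt : η / t * t = η := div_mul_cancel₀ _ ht.ne'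
    rcases le_or_gt ((Q + 24) * L + ℓ) (η / t * S) with hbig | hsmall
    -- The numerator of `s⋆` is tailored to this case: `24L` licenses the tilt, and `QL + log(4/α)`
    -- brings the sum down to `α/4`.
    · have h1 := hcore (η / t) (by positivity) ((div_le_one ht).2 hcase.le) hxt.le
        (by linarith)
      have h2 : Real.exp (Q * L - η / t * S) ≤ α := by
        calc Real.exp (Q * L - η / t * S) ≤ Real.exp (-ℓ) := Real.exp_le_exp.2 (by linarith)
          _ = α / 4 := by
              rw [hℓdef, Real.exp_neg, Real.exp_log (by positivity), inv_div]
          _ ≤ α := by linarith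
      have h3 := Real.exp_pos (-(1 / 2) * S)
      linarith
    · have h1 := expectedMismatch_le_one hb.le h.b_lt_a.le h.a_lt_n.le σ₀ M
      -- The claimed bound exceeds 1 here. The bias only shrinks the denominator, so any `C₀ > 0`
      -- works.
      have h2 : S ≤ t * (((Q + 24) * L + ℓ) / (η - B)) := by
        have hnum : 0 ≤ (Q + 24) * L + ℓ := by positivity
        calc S = t / η * (η / t * S) := by
              field_simp
          _ ≤ t / η * ((Q + 24) * L + ℓ) := by gcongr
          _ = t * (((Q + 24) * L + ℓ) / η) := by ring
          _ ≤ _ := by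
              gcongr
              linarith
      have h3 : 1 ≤ Z := Real.one_le_exp (by linarith)
      have h4 := Real.exp_pos (-(1 / 2) * S)
      have h5 := Real.exp_pos (-10 * (a + Real.log n))
      linarith

theorem Regime.eps_pos (h : Regime rlo rhi Cs Cmg n K β a b) {C ε : ℝ} (hC : 0 < C)
    (hη : 0 < eta n C a ε) : 0 < ε := by
  have hs := h.sens_pos hC
  unfold eta at hη
  have := (div_pos_iff_of_pos_right (by positivity : 0 < 4 * sens n C a)).1 hη
  exact this

/-- The size of `s⋆` when the privacy budget dominates the bias. -/
theorem Regime.sStar_le (h : Regime rlo rhi Cs Cmg n K β a b) (hCs : 0 < Cs) {C C₀ C₁ ε c₃ : ℝ}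
    (hC : 0 < C) (hC₀ : 0 < C₀) (hC₁ : 0 < C₁)
    (hη : 2 * bias n K C₀ a b ≤ eta n C a ε) (hc₃ : 0 < c₃) :
    sStar n K C C₀ C₁ a b ε (((n : ℝ) * K)⁻¹ * Real.exp (-c₃ * ε / 2)) ≤
      (8 * C₁ + 24) * (sens n C a * Real.log (n * K) / ε) +
        (8 * C₁ + 24) * (c₃ * sens n C a) := by
  have hB := h.bias_pos hCs hC₀
  have hε := h.eps_pos hC (by linarith : 0 < eta n C a ε)
  have hs := h.sens_pos hC
  have hL := h.one_le_log
  have hn : (0 : ℝ) < n := by exact_mod_cast (by linarith [h.two_le_n] : 0 < n)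
  have hK : (0 : ℝ) < K := by exact_mod_cast (by linarith [h.two_le_K] : 0 < K)
  have hlog : Real.log (4 / (((n : ℝ) * K)⁻¹ * Real.exp (-c₃ * ε / 2))) =
      Real.log 4 + Real.log (n * K) + c₃ * ε / 2 := by
    rw [Real.log_div (by norm_num) (by positivity), Real.log_mul (by positivity) (by positivity),
      Real.log_inv, Real.log_exp]
    ring
  have hlog4 : Real.log 4 ≤ 2 := by
    rw [show (4 : ℝ) = 2 ^ 2 by norm_num, Real.log_pow]
    have := Real.log_two_lt_d9
    push_cast
    linarith
  unfold sStar
  rw [hlog]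
  set L := Real.log (n * K)
  -- From `η ≥ 2B`, `η - B ≥ η/2`.
  have hden : ε / (8 * sens n C a) ≤ eta n C a ε - bias n K C₀ a b := by
    have : ε / (8 * sens n C a) = eta n C a ε / 2 := by
      unfold eta
      field_simp
      norm_num
    linarith
  have hnum : C₁ * L + (Real.log 4 + L + c₃ * ε / 2) ≤ (C₁ + 3) * L + c₃ * ε / 2 := by linarith
  calc (C₁ * L + (Real.log 4 + L + c₃ * ε / 2)) / (eta n C a ε - bias n K C₀ a b)
      ≤ ((C₁ + 3) * L + c₃ * ε / 2) / (ε / (8 * sens n C a)) := by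
        gcongr
    _ = (8 * C₁ + 24) * (sens n C a * L / ε) + 4 * (c₃ * sens n C a) := by
        field_simp
        ring
    _ ≤ _ := by
        have : 0 < c₃ * sens n C a := by positivity
        gcongr
        linarith

/-- The Chernoff tilt is bounded when the within-class edge probability stays away from one. -/
theorem Regime.tStar_le (h : Regime rlo rhi Cs Cmg n K β a b) (hlo : 0 < rlo) {κ : ℝ}
    (hκ : 0 < κ) (ha : a ≤ (1 - κ) * n) : tStar n a b ≤ -Real.log (rlo * κ) := by
  have hb := h.b_pos hlo
  have ha0 := h.a_pos
  have hn : 0 < (n : ℝ) := ha0.trans h.a_lt_n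
  have hone := one_lt_tilt_ratio hb h.b_lt_a h.a_lt_n
  have hp : κ ≤ 1 - a / n := by
    have : a / n ≤ 1 - κ := (div_le_iff₀ hn).2 ha
    linarith
  have hr : rlo * a ≤ b := (le_div_iff₀ ha0).1 h.le_ratio
  have hq : 0 ≤ b / n := by positivity
  have hle : a * (1 - b / n) / (b * (1 - a / n)) ≤ (rlo * κ)⁻¹ := by
    rw [inv_eq_one_div, div_le_div_iff₀ (mul_pos hb (by linarith)) (by positivity)]
    have h1 : rlo * a * κ ≤ b * (1 - a / n) := by gcongr
    have h2 : a * (1 - b / n) * (rlo * κ) ≤ a * 1 * (rlo * κ) := by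
      gcongr
      linarith
    linarith
  have hlog := Real.log_le_log (by linarith) hle
  -- Positivity of the logarithm allows the factor `1/2` in `t⋆` to be dropped.
  have hlog0 := Real.log_pos hone
  rw [Real.log_inv] at hlog
  unfold tStar
  linarith

end Regime

end NodeDPSBM

theorem theorem3p1 :
    ∃ Cenv : ℝ, 0 < Cenv ∧
    -- for `C ≥ Cenv` the block model lies in the degree envelope with high probability
    (∀ C : ℝ, Cenv ≤ C → ∀ (n K : ℕ) (a b : ℝ), 2 ≤ n → 0 ≤ b → b ≤ a → a ≤ n →
      ∀ σ₀ : Fin n → Fin K,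
        1 - Real.exp (-10 * (a + Real.log n)) ≤ sbmMeasure a b σ₀ (envelope n C a)) ∧
    -- the private estimator exists
    (∀ (n K : ℕ) (β a b w C ε : ℝ), 2 ≤ n → 0 < C → 0 < ε → (balanced n K β).Nonempty →
      ∃ M : SimpleGraph (Fin n) → PMF (Fin n → Fin K), IsPrivateEstimator β a b w C ε M) ∧
    ∀ Cmg rlo rhi : ℝ, 0 < Cmg → 0 < rlo → rlo ≤ rhi → rhi < 1 →
    ∃ Cs c₀ c₁ C₀ C₁ : ℝ, 0 < Cs ∧ 0 < c₀ ∧ 0 < c₁ ∧ 0 < C₀ ∧ 0 < C₁ ∧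
    ∃ δ : ℕ → ℝ, Tendsto δ atTop (𝓝 0) ∧
    -- the risk bound
    (∀ (n K : ℕ) (β a b w C ε : ℝ), Regime rlo rhi Cs Cmg n K β a b → 0 ≤ w → w ≤ 1 →
      Cenv ≤ C → 0 < eta n C a ε - bias n K C₀ a b →
      ∀ σ₀ ∈ balanced n K β, ∀ M : SimpleGraph (Fin n) → PMF (Fin n → Fin K),
      IsPrivateEstimator β a b w C ε M →
      ∀ α : ℝ, 0 < α → α < 1 / 2 →
        expectedMismatch a b σ₀ M ≤
          Real.exp (-(1 + δ n) * signal n K β a b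
              + tStar n a b * sStar n K C C₀ C₁ a b ε α)
            + α + Real.exp (-c₀ * signal n K β a b) + Real.exp (-c₁ * (a + Real.log n))) ∧
    -- the size of `s⋆` for `η ≥ 2B` and `α = (nK)⁻¹ exp(-c₃ ε / 2)`
    (∃ L : ℝ, 0 < L ∧ ∀ (n K : ℕ) (β a b C ε c₃ : ℝ), Regime rlo rhi Cs Cmg n K β a b →
      Cenv ≤ C → 2 * bias n K C₀ a b ≤ eta n C a ε → 0 < c₃ →
        sStar n K C C₀ C₁ a b ε (((n : ℝ) * K)⁻¹ * Real.exp (-c₃ * ε / 2)) ≤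
          L * (sens n C a * Real.log (n * K) / ε) + L * (c₃ * sens n C a)) ∧
    -- the simplified risk bound for `η ≥ 2B`
    (∀ κ : ℝ, 0 < κ → κ < 1 → ∃ L : ℝ, 0 < L ∧
      ∀ (n K : ℕ) (β a b w C ε c₃ : ℝ), Regime rlo rhi Cs Cmg n K β a b → 0 ≤ w → w ≤ 1 →
      Cenv ≤ C → a ≤ (1 - κ) * n → 2 * bias n K C₀ a b ≤ eta n C a ε → 0 < c₃ →
      ∀ σ₀ ∈ balanced n K β, ∀ M : SimpleGraph (Fin n) → PMF (Fin n → Fin K),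
      IsPrivateEstimator β a b w C ε M →
        expectedMismatch a b σ₀ M ≤
          Real.exp (-(1 + δ n) * signal n K β a b
              + L * (sens n C a * Real.log (n * K) / ε) + L * (c₃ * sens n C a))
            + ((n : ℝ) * K)⁻¹ * Real.exp (-c₃ * ε / 2)
            + Real.exp (-c₀ * signal n K β a b) + Real.exp (-c₁ * (a + Real.log n))) := by
  refine ⟨26, by norm_num, fun C hC n K a b hn hb hab han σ₀ =>
    le_sbmMeasure_envelope hC hn hb hab han σ₀,
    fun n K β a b w C ε hn hC hε hB => exists_isPrivateEstimator hn hC hε hB, ?_⟩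
  intro Cmg rlo rhi hCmg hlo hlohi hhi
  have hrate : 0 < riskRate Cmg rlo := by
    have h1 : Real.log rlo < 0 := Real.log_neg hlo (by linarith)
    have h2 : 0 < 1 / Cmg := by positivity
    unfold riskRate
    linarith
  set Q := riskRate Cmg rlo
  have hCs : 0 < 2 * Q + 24 := by linarith
  have hC₁ : 0 < Q + 24 := by linarith
  -- `2Q + 24` yields the rate `1/2` at full tilt, 10 is the envelope rate, and `Q + 24` is the
  -- entropy term of `s⋆`.
  refine ⟨2 * Q + 24, 1 / 2, 10, 1, Q + 24, hCs, by norm_num, by norm_num, one_pos, hC₁,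
    fun _ => 0, tendsto_const_nhds, ?_, ⟨8 * (Q + 24) + 24, by linarith, ?_⟩, ?_⟩
  · intro n K β a b w C ε h hw0 hw1 hC hγ σ₀ h₀ M hM α hα0 hα
    have := h.risk_bound hCmg hlo hrate rfl hw0 hw1 hC one_pos hγ h₀ hM hα0 hα
    rwa [add_zero, neg_one_mul]
  · intro n K β a b C ε c₃ h hC hη hc₃
    exact h.sStar_le hCs (by linarith) one_pos hC₁ hη hc₃
  · intro κ hκ hκ1
    have hT : 0 < -Real.log (rlo * κ) := by
      have : rlo * κ < 1 := by nlinarith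
      linarith [Real.log_neg (mul_pos hlo hκ) this]
    -- The product of the bound on `t⋆` and the constant in the bound on `s⋆`.
    refine ⟨-Real.log (rlo * κ) * (8 * (Q + 24) + 24), mul_pos hT (by linarith), ?_⟩
    intro n K β a b w C ε c₃ h hw0 hw1 hC ha hη hc₃ σ₀ h₀ M hM
    have hC0 : 0 < C := by linarith
    have hB := h.bias_pos hCs one_pos
    have hε := h.eps_pos hC0 (by linarith : 0 < eta n C a ε)
    have hs := h.sens_pos hC0
    have hL := h.one_le_log
    have hnK : (4 : ℝ) ≤ n * K := by
      have : 2 * 2 ≤ n * K := Nat.mul_le_mul h.two_le_n h.two_le_K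
      exact_mod_cast this
    have hα : ((n : ℝ) * K)⁻¹ * Real.exp (-c₃ * ε / 2) < 1 / 2 := by
      have h1 : ((n : ℝ) * K)⁻¹ ≤ 4⁻¹ := by gcongr
      have h2 : Real.exp (-c₃ * ε / 2) ≤ 1 := Real.exp_le_one_iff.2 (by
        have : 0 < c₃ * ε := by positivity
        linarith)
      have h3 := Real.exp_pos (-c₃ * ε / 2)
      nlinarith
    have hmain := h.risk_bound hCmg hlo hrate rfl hw0 hw1 hC one_pos (by linarith) h₀ hM
      (mul_pos (inv_pos.2 (by linarith)) (Real.exp_pos _)) hα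
    refine hmain.trans ?_
    have hexp : tStar n a b * sStar n K C 1 (Q + 24) a b ε
        (((n : ℝ) * K)⁻¹ * Real.exp (-c₃ * ε / 2)) ≤
        -Real.log (rlo * κ) * (8 * (Q + 24) + 24) * (sens n C a * Real.log (n * K) / ε) +
        -Real.log (rlo * κ) * (8 * (Q + 24) + 24) * (c₃ * sens n C a) := by
      have h1 := h.sStar_le hCs hC0 one_pos hC₁ hη hc₃
      have h2 := h.tStar_le hlo hκ ha
      have h3 := (tStar_pos (h.b_pos hlo) h.b_lt_a h.a_lt_n).le
      calc tStar n a b * sStar n K C 1 (Q + 24) a b ε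
            (((n : ℝ) * K)⁻¹ * Real.exp (-c₃ * ε / 2))
          ≤ tStar n a b * ((8 * (Q + 24) + 24) * (sens n C a * Real.log (n * K) / ε) +
            (8 * (Q + 24) + 24) * (c₃ * sens n C a)) := by gcongr
        _ ≤ -Real.log (rlo * κ) * ((8 * (Q + 24) + 24) * (sens n C a * Real.log (n * K) / ε) +
            (8 * (Q + 24) + 24) * (c₃ * sens n C a)) := by gcongr
        _ = _ := by ring
    refine add_le_add (add_le_add (add_le_add (Real.exp_le_exp.2 ?_) le_rfl) le_rfl) le_rfl
    simp only [add_zero, neg_one_mul]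
    linarith
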